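/- **Setting.** Let $R$ be a commutative ring. Graded modules are homologically graded, differentials have degree $-1$, and the Koszul sign rule is used. Let $u\mathcal{C}$ be a unitary, reduced, unital Hopf cooperad in chain complexes of $R$-modules, i.e. a cooperad in unital associative differential graded algebras, with products $\mu_r$ and units $\eta_r\in u\mathcal{C}(r)$, such that $u\mathcal{C}(0)=R\,\eta_0\cong R$ and the counit is an isomorphism $u\mathcal{C}(1)\cong R$. Assume that each $u\mathcal{C}(r)$ is finitely generated over $R$ in each degree and projective over $R$, and that either every $u\mathcal{C}(r)$ is free as an $R[\mathbb{S}_r]$-module or $\mathbb{Q}\subseteq R$. Let $V$ be a graded $R$-module with a complete Hausdorff descending filtration $V=F^1V\supseteq F^2V\supseteq\cdots$ by graded submodules, and let $$u\mathcal{C}(V)=\prod_{r\ge 0}\bigl(u\mathcal{C}(r)\,\widehat\otimes\, V^{\widehat\otimes r}\bigr)^{\mathbb{S}_r}$$ be the completed cofree $u\mathcal{C}$-coalgebra on $V$ (the invariants are identified with the coinvariants by the norm map). Let $\mathbf 1=\eta_0\in u\mathcal{C}(0)\subseteq u\mathcal{C}(V)$ and let $T:u\mathcal{C}(V)\to V$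 be the projection to the cogenerators $V=u\mathcal{C}(1)\otimes V$. The tensor product $u\mathcal{C}(V)\otimes u\mathcal{C}(V)$ is a $u\mathcal{C}$-coalgebra by means of the products $\mu_r$. The generalized shuffle product $\star:u\mathcal{C}(V)\otimes u\mathcal{C}(V)\to u\mathcal{C}(V)$ is the continuous morphism of $u\mathcal{C}$-coalgebras for which $T\circ\star$ is given by $\mathbf 1\otimes v\mapsto v$ and $v\otimes\mathbf 1\mapsto v$ for $v\in V$, and is zero on the other summands. For $v\in V_0$ let $\gamma_v:R[G]\to u\mathcal{C}(V)$, where $R[G]$ is the group ring of the additive group $G=\{g_\lambda\mid\lambda\in R\}$ of $R$, with coproducts $g_\lambda\mapsto(\eta_r\otimes g_\lambda^{\otimes r})_{r\ge 0}$, be the morphism of $u\mathcal{C}$-coalgebras with $T(\gamma_v(g_\lambda))=\lambda v$. Put $\exp(v)=\gamma_v(g_1)$. A curved $\Omega\mathcal{C}$-algebra structure on $V$ is a filtration preserving coderivation $Q$ of $u\mathcal{C}(V)$ of degree $-1$ (with respect to the differential of $u\mathcal{C}$) with $Q^2=0$. Write $\tilde Q=T\circ Q$ and let $\tilde Q_r$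 be its restriction to the arity $r$ factor. The curvature of $Q$ is $\tilde Q(\mathbf 1)$, and $Q$ is flat if its curvature is zero. The twist of $Q$ by $v\in V_0$ is $$Q^v(x)=\exp(-v)\star Q(\exp(v)\star x).$$ The element $v$ is a Maurer–Cartan element if $\tilde Q(\exp(v))=0$. **Proposition.** Let $(u\mathcal{C}(V),Q)$ be a curved $\Omega\mathcal{C}$-algebra and let $v\in V_0$. Then the twist $(u\mathcal{C}(V),Q^v)$ is flat, i.e. $T(Q^v(\mathbf 1))=0$, if and only if $v$ is a Maurer–Cartan element. Moreover the series $\sum_{r\ge 0}\tilde Q_r(\eta_r\otimes v^{\otimes r})$ converges to $\tilde Q(\exp(v))$ in the topology of the filtration, so that the Maurer–Cartan equation reads $$\sum_{r\ge 0}\tilde Q_r(\eta_r\otimes v^{\otimes r})=0 .$$ -/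

import Mathlib

open scoped TensorProduct

universe u v w x

namespace HopfTwist

noncomputable section

/-- The sign `(-1)^e`. -/
def sg (R : Type u) [CommRing R] (e : ZMod 2) : R := if e = 1 then -1 else 1

theorem zmod2_cases (e : ZMod 2) : e = 0 ∨ e = 1 := by
  revert e; decide

theorem sg_add (R : Type u) [CommRing R] (a b : ZMod 2) : sg R (a + b) = sg R a * sg R b := by
  have h : (1 : ZMod 2) + 1 = 0 := by decide
  rcases zmod2_cases a with rfl | rfl <;> rcases zmod2_cases b with rfl | rfl <;>
    simp [sg, h]

/-- The decomposition of a graded module into its even and its odd part, recorded by the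
projection onto the odd part.  This is all that enters into Koszul signs. -/
class Parity (R : Type u) (M : Type v) [CommRing R] [AddCommGroup M] [Module R M] where
  odd : M →ₗ[R] M
  odd_odd : odd ∘ₗ odd = odd

variable {R : Type u} [CommRing R]

section parity
variable {M : Type v} {N : Type w} [AddCommGroup M] [Module R M] [AddCommGroup N] [Module R N]

/-- The projection onto the part of parity `e`. -/
def par (R : Type u) {M : Type v} [CommRing R] [AddCommGroup M] [Module R M] [Parity R M]
    (e : ZMod 2) : M →ₗ[R] M :=
  if e = 1 then Parity.odd else LinearMap.id - Parity.odd

/-- The map `x ↦ (-1)^{|x|} x`. -/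
def signInvol (R : Type u) {M : Type v} [CommRing R] [AddCommGroup M] [Module R M] [Parity R M] :
    M →ₗ[R] M :=
  par R 0 - par R 1

variable [Parity R M] [Parity R N]

theorem par_sum : ∑ e, par R (M := M) e = LinearMap.id := by
  have : (Finset.univ : Finset (ZMod 2)) = {0, 1} := by decide
  rw [this]; simp [par]

theorem par_sum_apply (z : M) : ∑ e, par R e z = z := by
  have := congrArg (fun f => f z) (par_sum (R := R) (M := M))
  simpa using this

theorem par_comp (a b : ZMod 2) :
    par R (M := M) a ∘ₗ par R b = if a = b then par R a else 0 := by
  have h := Parity.odd_odd (R := R) (M := M)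
  rcases zmod2_cases a with rfl | rfl <;> rcases zmod2_cases b with rfl | rfl <;>
    simp [par, LinearMap.sub_comp, LinearMap.comp_sub, h]

/-- `z` is homogeneous of parity `e`. -/
def IsPar (R : Type u) {M : Type v} [CommRing R] [AddCommGroup M] [Module R M] [Parity R M]
    (e : ZMod 2) (z : M) : Prop := par R e z = z

theorem isPar_par (e : ZMod 2) (z : M) : IsPar R e (par R e z) := by
  have := congrArg (fun f => f z) (par_comp (R := R) (M := M) e e)
  simpa [IsPar] using this

theorem IsPar.apply {a : ZMod 2} {z : M} (h : IsPar R a z) (b : ZMod 2) :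
    par R b z = if b = a then z else 0 := by
  have := congrArg (fun f => f z) (par_comp (R := R) (M := M) b a)
  simp only [LinearMap.comp_apply] at this
  rw [h] at this
  rw [this]
  split_ifs with hab
  · subst hab; exact h
  · rfl

theorem isPar_of_zero {z : M} {e : ZMod 2} (h : par R (e + 1) z = 0) : IsPar R e z := by
  rcases zmod2_cases e with rfl | rfl
  · simp [par] at h; simp [IsPar, par, h]
  · have h11 : (1 : ZMod 2) + 1 = 0 := by decide
    simp [par, h11, sub_eq_zero] at h; simp [IsPar, par, ← h]

/-- A linear map that preserves parities. -/
def IsEven (f : M →ₗ[R] N) : Prop := ∀ e z, IsPar R e z → IsPar R e (f z)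

theorem IsEven.par_apply {f : M →ₗ[R] N} (hf : IsEven f) (e : ZMod 2) (z : M) :
    par R e (f z) = f (par R e z) := by
  conv_lhs => rw [← par_sum_apply (R := R) z, map_sum, map_sum]
  rw [Finset.sum_eq_single e]
  · exact hf e _ (isPar_par e z)
  · intro b _ hb
    rw [(hf b _ (isPar_par b z)).apply e, if_neg (Ne.symm hb)]
  · simp

instance : Parity R R := ⟨0, by simp⟩

instance tensorParity : Parity R (M ⊗[R] N) where
  odd := ∑ a : ZMod 2, TensorProduct.map (par R a) (par R (1 + a))
  odd_odd := by
    apply TensorProduct.ext'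
    intro z y
    have h : ∀ (a : ZMod 2) (z : M), par R a (par R a z) = par R a z := fun a z => isPar_par a z
    have h' : ∀ (a : ZMod 2) (z : N), par R a (par R a z) = par R a z := fun a z => isPar_par a z
    simp only [LinearMap.comp_apply, LinearMap.sum_apply, TensorProduct.map_tmul, map_sum]
    refine Finset.sum_congr rfl fun a _ => ?_
    rw [Finset.sum_eq_single a]
    · rw [h, h']
    · intro b _ hb; rw [(isPar_par a z).apply b, if_neg hb]; simp
    · simp

theorem IsPar.tmul {a b : ZMod 2} {z : M} {y : N} (hz : IsPar R a z) (hy : IsPar R b y) :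
    IsPar R (a + b) (z ⊗ₜ[R] y) := by
  have key : Parity.odd (R := R) (z ⊗ₜ[R] y) = if a + b = 1 then z ⊗ₜ[R] y else 0 := by
    simp only [Parity.odd, LinearMap.sum_apply, TensorProduct.map_tmul]
    rw [Finset.sum_eq_single a]
    · rw [hz.apply, hy.apply]
      rcases zmod2_cases a with rfl | rfl <;> rcases zmod2_cases b with rfl | rfl <;>
        simp [show (1 : ZMod 2) + 1 = 0 by decide]
    · intro c _ hc; rw [hz.apply, if_neg hc]; simp
    · simp
  unfold IsPar par
  split_ifs with h
  · rw [key, if_pos h]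
  · rw [LinearMap.sub_apply, key, if_neg h]; simp

end parity

section pi
variable {ι : Type} [Fintype ι] [DecidableEq ι] {X : ι → Type v} {Y : ι → Type w}
  [∀ i, AddCommGroup (X i)] [∀ i, Module R (X i)] [∀ i, Parity R (X i)]
  [∀ i, AddCommGroup (Y i)] [∀ i, Module R (Y i)] [∀ i, Parity R (Y i)]


theorem map_par_tprod {a : ι → ZMod 2} {z : ∀ i, X i} (h : ∀ i, IsPar R (a i) (z i))
    (b : ι → ZMod 2) :
    PiTensorProduct.map (fun i => par R (b i)) (PiTensorProduct.tprod R z)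
      = if b = a then PiTensorProduct.tprod R z else 0 := by
  rw [PiTensorProduct.map_tprod]
  split_ifs with hb
  · subst hb; congr 1; funext i; exact h i
  · obtain ⟨i, hi⟩ := Function.ne_iff.mp hb
    apply MultilinearMap.map_coord_zero _ i
    rw [(h i).apply, if_neg hi]

theorem tprod_eq_sum_par (z : ∀ i, X i) :
    PiTensorProduct.tprod R z
      = ∑ a : ι → ZMod 2, PiTensorProduct.tprod R fun i => par R (a i) (z i) := by
  have h := MultilinearMap.map_sum (PiTensorProduct.tprod R) (fun i (e : ZMod 2) => par R e (z i))
  simp only [par_sum_apply] at h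
  exact h

/-- Linear maps on a tensor product agree if they agree on homogeneous pure tensors. -/
theorem hom_ext_par {N : Type x} [AddCommMonoid N] [Module R N]
    {f g : (PiTensorProduct R X) →ₗ[R] N}
    (h : ∀ (a : ι → ZMod 2) (z : ∀ i, X i), (∀ i, IsPar R (a i) (z i)) →
      f (PiTensorProduct.tprod R z) = g (PiTensorProduct.tprod R z)) : f = g := by
  ext z
  simp only [LinearMap.compMultilinearMap_apply]
  rw [tprod_eq_sum_par (R := R) z, map_sum, map_sum]
  exact Finset.sum_congr rfl fun a _ => h a _ fun i => isPar_par _ _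

instance piParity : Parity R (PiTensorProduct R X) where
  odd := ∑ a : ι → ZMod 2, if ∑ i, a i = 1 then PiTensorProduct.map (fun i => par R (a i)) else 0
  odd_odd := by
    apply hom_ext_par
    intro a z h
    have key : (∑ b : ι → ZMod 2, if ∑ i, b i = 1 then
        PiTensorProduct.map (fun i => par R (M := X i) (b i)) else 0) (PiTensorProduct.tprod R z)
        = if ∑ i, a i = 1 then PiTensorProduct.tprod R z else 0 := by
      rw [LinearMap.sum_apply, Finset.sum_eq_single a]
      · split_ifs
        · rw [map_par_tprod h, if_pos rfl]
        · rfl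
      · intro b _ hb
        split_ifs
        · rw [map_par_tprod h, if_neg hb]
        · rfl
      · simp
    rw [LinearMap.comp_apply, key]
    split_ifs with hs
    · rw [key, if_pos hs]
    · simp

theorem IsPar.tprod {a : ι → ZMod 2} {z : ∀ i, X i} (h : ∀ i, IsPar R (a i) (z i)) :
    IsPar R (∑ i, a i) (PiTensorProduct.tprod R z) := by
  have key : Parity.odd (R := R) (PiTensorProduct.tprod R z)
      = if ∑ i, a i = 1 then PiTensorProduct.tprod R z else 0 := by
    simp only [Parity.odd]
    rw [LinearMap.sum_apply, Finset.sum_eq_single a]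
    · split_ifs
      · rw [map_par_tprod h, if_pos rfl]
      · rfl
    · intro b _ hb
      split_ifs
      · rw [map_par_tprod h, if_neg hb]
      · rfl
    · simp
  unfold IsPar par
  split_ifs with hs
  · rw [key, if_pos hs]
  · rw [LinearMap.sub_apply, key, if_neg hs]; simp

theorem IsEven.piMap {f : ∀ i, X i →ₗ[R] Y i} (hf : ∀ i, IsEven (f i)) :
    IsEven (PiTensorProduct.map f) := by
  have key : ∀ e, par R e ∘ₗ PiTensorProduct.map f = PiTensorProduct.map f ∘ₗ par R e := by
    intro e
    apply hom_ext_par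
    intro a z h
    simp only [LinearMap.comp_apply, PiTensorProduct.map_tprod]
    rw [(IsPar.tprod h).apply, (IsPar.tprod fun i => hf i _ _ (h i)).apply]
    split_ifs <;> simp
  intro e z hz
  have := congrArg (fun g => g z) (key e)
  simp only [LinearMap.comp_apply] at this
  unfold IsPar; rw [this, hz]

end pi

section koszul
variable {k l : ℕ}

/-- The Koszul sign of permuting, by `e`, homogeneous factors of parities `a`. -/
def permSign (R : Type u) [CommRing R] (e : Fin k ≃ Fin l) (a : Fin k → ZMod 2) : R :=
  sg R (∑ i, ∑ j, if i < j ∧ e j < e i then a i * a j else 0)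

/-- The Koszul sign of the rearrangement
`x₁ ⋯ x_k y₁ ⋯ y_k ↦ x₁ y₁ ⋯ x_k y_k` with `x` of parities `a` and `y` of parities `b`. -/
def interSign (R : Type u) [CommRing R] (a b : Fin k → ZMod 2) : R :=
  sg R (∑ i, ∑ j, if i < j then a j * b i else 0)

variable {X : Fin k → Type v} {Y : Fin k → Type w}
  [∀ i, AddCommGroup (X i)] [∀ i, Module R (X i)] [∀ i, Parity R (X i)]
  [∀ i, AddCommGroup (Y i)] [∀ i, Module R (Y i)] [∀ i, Parity R (Y i)]

/-- The permutation of tensor factors along `e`, with Koszul signs. -/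
def permute (e : Fin k ≃ Fin l) :
    (PiTensorProduct R X) →ₗ[R] PiTensorProduct R fun j => X (e.symm j) :=
  ∑ a : Fin k → ZMod 2, permSign R e a •
    ((PiTensorProduct.reindex R X e).toLinearMap ∘ₗ PiTensorProduct.map fun i => par R (a i))

/-- The rearrangement `x₁ ⊗ ⋯ ⊗ x_k ⊗ y₁ ⊗ ⋯ ⊗ y_k ↦ ± (x₁ ⊗ y₁) ⊗ ⋯ ⊗ (x_k ⊗ y_k)`. -/
def interleave : (PiTensorProduct R X) ⊗[R] (PiTensorProduct R Y) →ₗ[R]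
    PiTensorProduct R fun j => X j ⊗[R] Y j :=
  ∑ a : Fin k → ZMod 2, ∑ b : Fin k → ZMod 2, interSign R a b •
    (TensorProduct.lift (PiTensorProduct.map₂ fun j => TensorProduct.mk R (X j) (Y j)) ∘ₗ
      TensorProduct.map (PiTensorProduct.map fun i => par R (a i))
        (PiTensorProduct.map fun i => par R (b i)))

/-- The rearrangement `m ⊗ n ⊗ m' ⊗ n' ↦ (-1)^{|n| |m'|} m ⊗ m' ⊗ n ⊗ n'`. -/
def middleSwap {M N M' N' : Type*} [AddCommGroup M] [Module R M] [AddCommGroup N] [Module R N]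
    [AddCommGroup M'] [Module R M'] [AddCommGroup N'] [Module R N'] [Parity R N] [Parity R M'] :
    (M ⊗[R] N) ⊗[R] (M' ⊗[R] N') →ₗ[R] (M ⊗[R] M') ⊗[R] (N ⊗[R] N') :=
  ∑ a : ZMod 2, ∑ b : ZMod 2, sg R (a * b) •
    ((TensorProduct.tensorTensorTensorComm R M N M' N').toLinearMap ∘ₗ
      TensorProduct.map ((par R a).lTensor M) ((par R b).rTensor N'))

theorem permute_tprod (e : Fin k ≃ Fin l) {a : Fin k → ZMod 2} {z : ∀ i, X i}
    (h : ∀ i, IsPar R (a i) (z i)) :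
    permute e (PiTensorProduct.tprod R z)
      = permSign R e a • PiTensorProduct.tprod R fun j => z (e.symm j) := by
  rw [permute, LinearMap.sum_apply, Finset.sum_eq_single a]
  · simp [-PiTensorProduct.map_tprod, map_par_tprod h]
  · intro b _ hb
    simp [-PiTensorProduct.map_tprod, map_par_tprod h, hb]
  · simp

theorem interleave_tprod {a b : Fin k → ZMod 2} {z : ∀ i, X i} {y : ∀ i, Y i}
    (hz : ∀ i, IsPar R (a i) (z i)) (hy : ∀ i, IsPar R (b i) (y i)) :
    interleave (PiTensorProduct.tprod R z ⊗ₜ[R] PiTensorProduct.tprod R y)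
      = interSign R a b • PiTensorProduct.tprod R fun j => z j ⊗ₜ[R] y j := by
  rw [interleave, LinearMap.sum_apply, Finset.sum_eq_single a]
  · rw [LinearMap.sum_apply, Finset.sum_eq_single b]
    · simp [-PiTensorProduct.map_tprod, map_par_tprod hz, map_par_tprod hy,
        PiTensorProduct.map₂_tprod_tprod]
    · intro c _ hc
      simp [-PiTensorProduct.map_tprod, map_par_tprod hz, map_par_tprod hy, hc]
    · simp
  · intro c _ hc
    rw [LinearMap.sum_apply]
    refine Finset.sum_eq_zero fun d _ => ?_
    simp [-PiTensorProduct.map_tprod, map_par_tprod hz, hc]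
  · simp

theorem permute_even (e : Fin k ≃ Fin l) : IsEven (permute (R := R) (X := X) e) := by
  have key : ∀ c, par R c ∘ₗ permute (R := R) (X := X) e = permute e ∘ₗ par R c := by
    intro c
    apply hom_ext_par
    intro a z h
    have hs : ∑ i, a i = ∑ j, a (e.symm j) := (Equiv.sum_comp e.symm a).symm
    simp only [LinearMap.comp_apply]
    rw [permute_tprod e h, (IsPar.tprod h).apply, map_smul,
      (IsPar.tprod (R := R) (a := fun j => a (e.symm j)) fun j => h (e.symm j)).apply, hs]
    split_ifs
    · rw [permute_tprod e h]
    · simp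
  intro c z hz
  have := congrArg (fun g => g z) (key c)
  simp only [LinearMap.comp_apply] at this
  unfold IsPar; rw [this, hz]

theorem permute_map (e : Fin k ≃ Fin l) {f : ∀ i, X i →ₗ[R] Y i} (hf : ∀ i, IsEven (f i)) :
    permute e ∘ₗ PiTensorProduct.map f
      = PiTensorProduct.map (fun j => f (e.symm j)) ∘ₗ permute e := by
  apply hom_ext_par
  intro a z h
  simp only [LinearMap.comp_apply, PiTensorProduct.map_tprod]
  rw [permute_tprod e h, permute_tprod e fun i => hf i _ _ (h i)]
  simp

theorem inter_perm_sign (e : Fin k ≃ Fin l) (a b : Fin k → ZMod 2) :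
    interSign R a b * permSign R e (fun i => a i + b i)
      = permSign R e a * permSign R e b *
        interSign R (fun j => a (e.symm j)) (fun j => b (e.symm j)) := by
  unfold interSign permSign
  simp only [← sg_add]
  congr 1
  have h1 : (∑ i, ∑ j, if i < j then a (e.symm j) * b (e.symm i) else 0)
      = ∑ i, ∑ j, if e i < e j then a j * b i else 0 := by
    rw [← Equiv.sum_comp e]
    refine Finset.sum_congr rfl fun i _ => ?_
    rw [← Equiv.sum_comp e]
    simp
  rw [h1]
  have h2 : (∑ i, ∑ j, if i < j ∧ e j < e i then (a i + b i) * (a j + b j) else 0)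
     = (∑ i, ∑ j, if i < j ∧ e j < e i then a i * a j else 0)
      + (∑ i, ∑ j, if i < j ∧ e j < e i then b i * b j else 0)
      + ((∑ i, ∑ j, if i < j ∧ e j < e i then a j * b i else 0)
        + (∑ i, ∑ j, if j < i ∧ e i < e j then a j * b i else 0)) := by
    have h3 : (∑ i, ∑ j, if j < i ∧ e i < e j then a j * b i else 0)
      = ∑ i, ∑ j, if i < j ∧ e j < e i then a i * b j else 0 := Finset.sum_comm
    rw [h3]
    simp only [← Finset.sum_add_distrib]
    refine Finset.sum_congr rfl fun i _ => Finset.sum_congr rfl fun j _ => ?_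
    split_ifs
    · ring
    · simp
  rw [h2]
  have h4 : (∑ i, ∑ j, if i < j then a j * b i else 0)
      + ((∑ i, ∑ j, if i < j ∧ e j < e i then a j * b i else 0)
        + (∑ i, ∑ j, if j < i ∧ e i < e j then a j * b i else 0))
      = ∑ i, ∑ j, if e i < e j then a j * b i else 0 := by
    simp only [← Finset.sum_add_distrib]
    refine Finset.sum_congr rfl fun i _ => Finset.sum_congr rfl fun j _ => ?_
    have hc : a j * b i + a j * b i = 0 := CharTwo.add_self_eq_zero _
    rcases lt_trichotomy i j with hij | rfl | hij
    · have hne : e i ≠ e j := fun h => hij.ne (e.injective h)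
      rcases lt_or_gt_of_ne hne with h | h
      · simp [hij, h, hij.not_gt, h.not_gt]
      · simp [hij, h, hij.not_gt, h.not_gt, hc]
    · simp
    · have hne : e i ≠ e j := fun h => hij.ne (e.injective h).symm
      rcases lt_or_gt_of_ne hne with h | h
      · simp [hij, h, hij.not_gt, h.not_gt]
      · simp [hij, h, hij.not_gt, h.not_gt]
  rw [← h4]; ring

theorem permute_interleave (e : Fin k ≃ Fin l) :
    permute (R := R) e ∘ₗ interleave (X := X) (Y := Y)
      = interleave ∘ₗ TensorProduct.map (permute e) (permute e) := by
  apply TensorProduct.curry_injective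
  apply hom_ext_par
  intro a z hz
  apply hom_ext_par
  intro b y hy
  simp only [TensorProduct.curry_apply, LinearMap.comp_apply, TensorProduct.map_tmul]
  rw [interleave_tprod hz hy, permute_tprod e hz, permute_tprod e hy, map_smul,
    permute_tprod e fun i => (hz i).tmul (hy i), TensorProduct.smul_tmul_smul, map_smul,
    interleave_tprod (R := R) (a := fun j => a (e.symm j)) (b := fun j => b (e.symm j))
      (fun j => hz (e.symm j)) (fun j => hy (e.symm j)), smul_smul, smul_smul,
    inter_perm_sign]

theorem middleSwap_map {M N M' N' P Q P' Q' : Type*} [AddCommGroup M] [Module R M]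
    [AddCommGroup N] [Module R N] [AddCommGroup M'] [Module R M'] [AddCommGroup N'] [Module R N']
    [AddCommGroup P] [Module R P] [AddCommGroup Q] [Module R Q] [AddCommGroup P'] [Module R P']
    [AddCommGroup Q'] [Module R Q']
    [Parity R N] [Parity R M'] [Parity R Q] [Parity R P']
    (f : M →ₗ[R] P) {g : N →ₗ[R] Q} {f' : M' →ₗ[R] P'} (g' : N' →ₗ[R] Q')
    (hg : IsEven g) (hf' : IsEven f') :
    middleSwap ∘ₗ TensorProduct.map (TensorProduct.map f g) (TensorProduct.map f' g')
      = TensorProduct.map (TensorProduct.map f f') (TensorProduct.map g g') ∘ₗ middleSwap := by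
  apply TensorProduct.ext_fourfold'
  intro m n m' n'
  simp [middleSwap, map_sum, hg.par_apply, hf'.par_apply]

end koszul

section filtered

/-- A descending filtration `M = F⁰M ⊇ F¹M ⊇ ⋯` by submodules. -/
class Fil (R : Type u) (M : Type v) [CommRing R] [AddCommGroup M] [Module R M] where
  fil : ℕ → Submodule R M
  anti : Antitone fil
  zero : fil 0 = ⊤

section basic
variable {M : Type v} {N : Type w} {P : Type x}
  [AddCommGroup M] [Module R M] [AddCommGroup N] [Module R N] [AddCommGroup P] [Module R P]

/-- A linear map that respects the filtrations. -/
def IsFil [Fil R M] [Fil R N] (f : M →ₗ[R] N) : Prop :=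
  ∀ n z, z ∈ Fil.fil (R := R) n → f z ∈ Fil.fil (R := R) n

/-- The filtration of `M ⊗ N` for a filtered module `N` and an unfiltered module `M`. -/
instance tensorFil [Fil R N] : Fil R (M ⊗[R] N) where
  fil n := Submodule.span R {z | ∃ (m : M) (y : N), y ∈ Fil.fil (R := R) n ∧ z = m ⊗ₜ y}
  anti := by
    intro a b hab
    apply Submodule.span_mono
    rintro z ⟨m, y, hy, rfl⟩
    exact ⟨m, y, Fil.anti hab hy, rfl⟩
  zero := by
    rw [eq_top_iff, ← TensorProduct.span_tmul_eq_top R M N]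
    apply Submodule.span_mono
    rintro z ⟨m, y, rfl⟩
    exact ⟨m, y, by rw [Fil.zero]; trivial, rfl⟩

/-- The filtration of a tensor product of filtered modules: `Fⁿ` is spanned by the
`y₁ ⊗ ⋯ ⊗ y_k` with `yᵢ ∈ F^{dᵢ}` and `d₁ + ⋯ + d_k ≥ n`. -/
instance piFil {ι : Type} [Fintype ι] {X : ι → Type v} [∀ i, AddCommGroup (X i)]
    [∀ i, Module R (X i)] [∀ i, Fil R (X i)] : Fil R (PiTensorProduct R X) where
  fil n := Submodule.span R {z | ∃ (d : ι → ℕ) (y : ∀ i, X i),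
    (∀ i, y i ∈ Fil.fil (R := R) (d i)) ∧ n ≤ ∑ i, d i ∧ z = PiTensorProduct.tprod R y}
  anti := by
    intro a b hab
    apply Submodule.span_mono
    rintro z ⟨d, y, hy, hd, rfl⟩
    exact ⟨d, y, hy, hab.trans hd, rfl⟩
  zero := by
    rw [eq_top_iff, ← PiTensorProduct.span_tprod_eq_top]
    apply Submodule.span_mono
    rintro z ⟨y, rfl⟩
    exact ⟨0, y, fun i => by simp [Fil.zero], by simp, rfl⟩

theorem tmul_mem_fil [Fil R N] {n : ℕ} (m : M) {y : N} (hy : y ∈ Fil.fil (R := R) n) :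
    m ⊗ₜ[R] y ∈ Fil.fil (R := R) (M := M ⊗[R] N) n :=
  Submodule.subset_span ⟨m, y, hy, rfl⟩

theorem tprod_mem_fil {ι : Type} [Fintype ι] {X : ι → Type v} [∀ i, AddCommGroup (X i)]
    [∀ i, Module R (X i)] [∀ i, Fil R (X i)] {n : ℕ} (d : ι → ℕ) {y : ∀ i, X i}
    (hy : ∀ i, y i ∈ Fil.fil (R := R) (d i)) (hd : n ≤ ∑ i, d i) :
    PiTensorProduct.tprod R y ∈ Fil.fil (R := R) (M := PiTensorProduct R X) n :=
  Submodule.subset_span ⟨d, y, hy, hd, rfl⟩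

theorem isFil_of_tmul [Fil R N] [Fil R P] {f : M ⊗[R] N →ₗ[R] P}
    (h : ∀ n m y, y ∈ Fil.fil (R := R) n → f (m ⊗ₜ y) ∈ Fil.fil (R := R) n) : IsFil f := by
  intro n z hz
  have : Fil.fil (R := R) (M := M ⊗[R] N) n ≤ (Fil.fil n).comap f := by
    refine Submodule.span_le.mpr ?_
    rintro _ ⟨m, y, hy, rfl⟩
    exact h n m y hy
  exact this hz

theorem isFil_of_tprod {ι : Type} [Fintype ι] {X : ι → Type v} [∀ i, AddCommGroup (X i)]
    [∀ i, Module R (X i)] [∀ i, Fil R (X i)] [Fil R P] {f : PiTensorProduct R X →ₗ[R] P}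
    (h : ∀ (d : ι → ℕ) (y : ∀ i, X i), (∀ i, y i ∈ Fil.fil (R := R) (d i)) →
      f (PiTensorProduct.tprod R y) ∈ Fil.fil (R := R) (∑ i, d i)) : IsFil f := by
  intro n z hz
  have : Fil.fil (R := R) (M := PiTensorProduct R X) n ≤ (Fil.fil n).comap f := by
    refine Submodule.span_le.mpr ?_
    rintro _ ⟨d, y, hy, hd, rfl⟩
    exact Fil.anti hd (h d y hy)
  exact this hz

theorem IsFil.comp [Fil R M] [Fil R N] [Fil R P] {g : N →ₗ[R] P} {f : M →ₗ[R] N}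
    (hg : IsFil g) (hf : IsFil f) : IsFil (g ∘ₗ f) :=
  fun n z hz => hg n _ (hf n z hz)

theorem IsFil.id [Fil R M] : IsFil (LinearMap.id : M →ₗ[R] M) := fun _ _ h => h

theorem IsFil.add [Fil R M] [Fil R N] {f g : M →ₗ[R] N} (hf : IsFil f) (hg : IsFil g) :
    IsFil (f + g) :=
  fun n z hz => Submodule.add_mem _ (hf n z hz) (hg n z hz)

theorem IsFil.sub [Fil R M] [Fil R N] {f g : M →ₗ[R] N} (hf : IsFil f) (hg : IsFil g) :
    IsFil (f - g) :=
  fun n z hz => Submodule.sub_mem _ (hf n z hz) (hg n z hz)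

theorem IsFil.smul [Fil R M] [Fil R N] {f : M →ₗ[R] N} (t : R) (hf : IsFil f) :
    IsFil (t • f) :=
  fun n z hz => Submodule.smul_mem _ _ (hf n z hz)

theorem IsFil.sum [Fil R M] [Fil R N] {κ : Type*} {s : Finset κ} {f : κ → M →ₗ[R] N}
    (hf : ∀ i ∈ s, IsFil (f i)) : IsFil (∑ i ∈ s, f i) := by
  intro n z hz
  rw [LinearMap.sum_apply]
  exact Submodule.sum_mem _ fun i hi => hf i hi n z hz

theorem IsFil.tensorMap {M' : Type*} [AddCommGroup M'] [Module R M'] [Fil R N] [Fil R P]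
    (f : M →ₗ[R] M') {g : N →ₗ[R] P} (hg : IsFil g) : IsFil (TensorProduct.map f g) :=
  isFil_of_tmul fun n m y hy => by
    rw [TensorProduct.map_tmul]; exact tmul_mem_fil _ (hg n y hy)

theorem IsFil.piMap {ι : Type} [Fintype ι] {X : ι → Type v} {Y : ι → Type w}
    [∀ i, AddCommGroup (X i)] [∀ i, Module R (X i)] [∀ i, Fil R (X i)]
    [∀ i, AddCommGroup (Y i)] [∀ i, Module R (Y i)] [∀ i, Fil R (Y i)]
    {f : ∀ i, X i →ₗ[R] Y i} (hf : ∀ i, IsFil (f i)) : IsFil (PiTensorProduct.map f) :=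
  isFil_of_tprod fun d y hy => by
    rw [PiTensorProduct.map_tprod]
    exact tprod_mem_fil d (fun i => hf i _ _ (hy i)) le_rfl

end basic

/-- The parity projections respect the filtration. -/
class FilPar (R : Type u) (M : Type v) [CommRing R] [AddCommGroup M] [Module R M]
    [Parity R M] [Fil R M] : Prop where
  odd_fil : IsFil (Parity.odd (R := R) (M := M))

section filpar
variable {M : Type v} {N : Type w} [AddCommGroup M] [Module R M] [AddCommGroup N] [Module R N]

theorem isFil_par [Parity R M] [Fil R M] [FilPar R M] (e : ZMod 2) :
    IsFil (par R (M := M) e) := by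
  unfold par
  split_ifs
  · exact FilPar.odd_fil
  · exact IsFil.id.sub FilPar.odd_fil

theorem isFil_signInvol [Parity R M] [Fil R M] [FilPar R M] :
    IsFil (signInvol R (M := M)) := (isFil_par 0).sub (isFil_par 1)

instance [Parity R M] [Parity R N] [Fil R N] [FilPar R N] : FilPar R (M ⊗[R] N) where
  odd_fil := IsFil.sum fun _ _ => IsFil.tensorMap _ (isFil_par _)

instance {ι : Type} [Fintype ι] [DecidableEq ι] {X : ι → Type v} [∀ i, AddCommGroup (X i)]
    [∀ i, Module R (X i)] [∀ i, Parity R (X i)] [∀ i, Fil R (X i)] [∀ i, FilPar R (X i)] :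
    FilPar R (PiTensorProduct R X) where
  odd_fil := IsFil.sum fun a _ => by
    split_ifs
    · exact IsFil.piMap fun i => isFil_par _
    · exact fun n z _ => Submodule.zero_mem _

end filpar

section koszulfil
variable {k l : ℕ} {X : Fin k → Type v} {Y : Fin k → Type w}
  [∀ i, AddCommGroup (X i)] [∀ i, Module R (X i)] [∀ i, Parity R (X i)]
  [∀ i, AddCommGroup (Y i)] [∀ i, Module R (Y i)] [∀ i, Parity R (Y i)]

theorem isFil_permute [∀ i, Fil R (X i)] [∀ i, FilPar R (X i)] (e : Fin k ≃ Fin l) :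
    IsFil (permute (R := R) (X := X) e) := by
  refine IsFil.sum fun a _ => IsFil.smul _ (IsFil.comp ?_ (IsFil.piMap fun i => isFil_par _))
  refine isFil_of_tprod fun d y hy => ?_
  rw [LinearEquiv.coe_coe, PiTensorProduct.reindex_tprod]
  exact tprod_mem_fil (fun j => d (e.symm j)) (fun j => hy _)
    (le_of_eq (Equiv.sum_comp e.symm d).symm)

theorem interleave_apply_tprod (z : ∀ i, X i) (y : ∀ i, Y i) :
    interleave (PiTensorProduct.tprod R z ⊗ₜ[R] PiTensorProduct.tprod R y)
      = ∑ a : Fin k → ZMod 2, ∑ b : Fin k → ZMod 2, interSign R a b •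
        PiTensorProduct.tprod R fun j => par R (a j) (z j) ⊗ₜ[R] par R (b j) (y j) := by
  simp [interleave, LinearMap.sum_apply, PiTensorProduct.map₂_tprod_tprod]

theorem isFil_interleave [∀ i, Fil R (Y i)] [∀ i, FilPar R (Y i)] :
    IsFil (interleave (R := R) (X := X) (Y := Y)) := by
  refine isFil_of_tmul fun n m y hy => ?_
  induction m using PiTensorProduct.induction_on with
  | smul_tprod r z =>
    rw [← TensorProduct.smul_tmul', map_smul]
    refine Submodule.smul_mem _ _ ?_
    revert n y
    refine isFil_of_tprod (f := interleave ∘ₗ TensorProduct.mk R _ _ (PiTensorProduct.tprod R z))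
      fun d y hy => ?_
    rw [LinearMap.comp_apply, TensorProduct.mk_apply, interleave_apply_tprod]
    refine Submodule.sum_mem _ fun a _ => Submodule.sum_mem _ fun b _ => Submodule.smul_mem _ _ ?_
    exact tprod_mem_fil d (fun j => tmul_mem_fil _ (isFil_par _ _ _ (hy j))) le_rfl
  | add z z' hz hz' =>
    rw [TensorProduct.add_tmul, map_add]
    exact Submodule.add_mem _ hz hz'

end koszulfil

section completion
variable (R)
variable (M : Type v) {N : Type w} {P : Type x}
  [AddCommGroup M] [Module R M] [AddCommGroup N] [Module R N] [AddCommGroup P] [Module R P]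
  [Fil R M] [Fil R N] [Fil R P]

/-- The submodule of compatible families in the product of the quotients `M / FⁿM`. -/
def hatSubmodule : Submodule R (∀ n, M ⧸ Fil.fil (R := R) (M := M) n) where
  carrier := {z | ∀ m n (h : m ≤ n), Submodule.factor (Fil.anti h) (z n) = z m}
  zero_mem' := fun m n h => by simp
  add_mem' := fun {a b} ha hb m n h => by
    simp only [Pi.add_apply, map_add, ha m n h, hb m n h]
  smul_mem' := fun t a ha m n h => by
    simp only [Pi.smul_apply, map_smul, ha m n h]

/-- The completion `lim M / FⁿM` of a filtered module. -/
def Hat : Type v := hatSubmodule R M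

instance : AddCommGroup (Hat R M) := inferInstanceAs (AddCommGroup (hatSubmodule R M))

instance : Module R (Hat R M) := inferInstanceAs (Module R (hatSubmodule R M))

variable {R} {M}

/-- The projection of the completion to `M / FⁿM`. -/
def Hat.proj (n : ℕ) : Hat R M →ₗ[R] M ⧸ Fil.fil (R := R) (M := M) n :=
  LinearMap.proj n ∘ₗ (hatSubmodule R M).subtype

theorem Hat.ext {z y : Hat R M} (h : ∀ n, Hat.proj n z = Hat.proj n y) : z = y :=
  Subtype.ext (funext h)

theorem Hat.factor_proj (z : Hat R M) {m n : ℕ} (h : m ≤ n) :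
    Submodule.factor (Fil.anti h) (Hat.proj n z) = Hat.proj m z := z.2 m n h

/-- Linear maps to the completion from compatible families of maps to the quotients. -/
def Hat.lift {P : Type x} [AddCommGroup P] [Module R P] (f : ∀ n, P →ₗ[R] M ⧸ Fil.fil (R := R) (M := M) n)
    (h : ∀ z m n (h : m ≤ n), Submodule.factor (Fil.anti h) (f n z) = f m z) :
    P →ₗ[R] Hat R M :=
  LinearMap.codRestrict (hatSubmodule R M) (LinearMap.pi f) h

theorem Hat.proj_lift {P : Type x} [AddCommGroup P] [Module R P] (f : ∀ n, P →ₗ[R] M ⧸ Fil.fil (R := R) (M := M) n)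
    (h : ∀ z m n (h : m ≤ n), Submodule.factor (Fil.anti h) (f n z) = f m z) (z : P) (n : ℕ) :
    Hat.proj n (Hat.lift f h z) = f n z := rfl

/-- The filtration of the completion: `Fⁿ` is the kernel of the projection to `M / FⁿM`. -/
instance hatFil : Fil R (Hat R M) where
  fil n := LinearMap.ker (Hat.proj n)
  anti := by
    intro a b hab z hz
    rw [LinearMap.mem_ker] at hz ⊢
    rw [← z.factor_proj hab, hz, map_zero]
  zero := by
    rw [eq_top_iff]
    intro z _
    rw [LinearMap.mem_ker]
    obtain ⟨m, hm⟩ := Submodule.Quotient.mk_surjective _ (Hat.proj 0 z)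
    rw [← hm, Submodule.Quotient.mk_eq_zero, Fil.zero]
    trivial

theorem mem_hatFil {n : ℕ} {z : Hat R M} : z ∈ Fil.fil (R := R) n ↔ Hat.proj n z = 0 := Iff.rfl

/-- The canonical map to the completion. -/
def Hat.of : M →ₗ[R] Hat R M :=
  Hat.lift (fun n => (Fil.fil (R := R) n).mkQ) fun _ _ _ _ => rfl

theorem Hat.proj_of (m : M) (n : ℕ) :
    Hat.proj n (Hat.of m : Hat R M) = Submodule.Quotient.mk m := rfl

theorem isFil_of : IsFil (Hat.of (R := R) (M := M)) := fun n z hz => by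
  rw [mem_hatFil, Hat.proj_of, Submodule.Quotient.mk_eq_zero]; exact hz

/-- The continuous extension of a filtered map to the completions. -/
def Hat.map (f : M →ₗ[R] N) (hf : IsFil f) : Hat R M →ₗ[R] Hat R N :=
  Hat.lift (fun n => (Submodule.mapQ _ _ f (hf n)) ∘ₗ Hat.proj n)
    fun z m n h => by
      rw [LinearMap.comp_apply, LinearMap.comp_apply, ← z.factor_proj h]
      obtain ⟨y, hy⟩ := Submodule.Quotient.mk_surjective _ (Hat.proj n z)
      rw [← hy]; rfl

theorem Hat.proj_map (f : M →ₗ[R] N) (hf : IsFil f) (z : Hat R M) (n : ℕ) :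
    Hat.proj n (Hat.map f hf z) = Submodule.mapQ _ _ f (hf n) (Hat.proj n z) := rfl

theorem Hat.map_of (f : M →ₗ[R] N) (hf : IsFil f) (m : M) :
    Hat.map f hf (Hat.of m) = Hat.of (f m) := rfl

theorem isFil_hatMap (f : M →ₗ[R] N) (hf : IsFil f) : IsFil (Hat.map f hf) := fun n z hz => by
  rw [mem_hatFil] at hz ⊢
  rw [Hat.proj_map, hz, map_zero]

theorem Hat.map_map (g : N →ₗ[R] P) (hg : IsFil g) (f : M →ₗ[R] N) (hf : IsFil f) (z : Hat R M) :
    Hat.map g hg (Hat.map f hf z) = Hat.map (g ∘ₗ f) (hg.comp hf) z := by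
  apply Hat.ext; intro n
  simp only [Hat.proj_map]
  obtain ⟨y, hy⟩ := Submodule.Quotient.mk_surjective _ (Hat.proj n z)
  rw [← hy]; rfl

theorem Hat.map_id (z : Hat R M) : Hat.map LinearMap.id IsFil.id z = z := by
  apply Hat.ext; intro n
  rw [Hat.proj_map]
  obtain ⟨y, hy⟩ := Submodule.Quotient.mk_surjective _ (Hat.proj n z)
  rw [← hy]; rfl

/-- A bilinear map that respects the filtrations in each variable. -/
structure IsFil₂ (B : M →ₗ[R] N →ₗ[R] P) : Prop where
  left : ∀ n z y, z ∈ Fil.fil (R := R) n → B z y ∈ Fil.fil (R := R) n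
  right : ∀ n z y, y ∈ Fil.fil (R := R) n → B z y ∈ Fil.fil (R := R) n

/-- The bilinear map induced modulo `Fⁿ`. -/
def quotMap₂ (B : M →ₗ[R] N →ₗ[R] P) (hB : IsFil₂ B) (n : ℕ) :
    (M ⧸ Fil.fil (R := R) (M := M) n) →ₗ[R] (N ⧸ Fil.fil (R := R) (M := N) n) →ₗ[R]
      (P ⧸ Fil.fil (R := R) (M := P) n) :=
  Submodule.liftQ _
    { toFun := fun m => Submodule.mapQ _ _ (B m) fun y hy => hB.right n m y hy
      map_add' := fun a b => by ext y; simp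
      map_smul' := fun t a => by ext y; simp }
    fun m hm => by
      rw [LinearMap.mem_ker]
      ext y
      simpa using hB.left n m y hm

theorem quotMap₂_mk (B : M →ₗ[R] N →ₗ[R] P) (hB : IsFil₂ B) (n : ℕ) (m : M) (y : N) :
    quotMap₂ B hB n (Submodule.Quotient.mk m) (Submodule.Quotient.mk y)
      = Submodule.Quotient.mk (B m y) := rfl

/-- The continuous extension of a filtered bilinear map to the completions. -/
def Hat.map₂ (B : M →ₗ[R] N →ₗ[R] P) (hB : IsFil₂ B) : Hat R M →ₗ[R] Hat R N →ₗ[R] Hat R P :=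
  LinearMap.mk₂ R
    (fun z => Hat.lift (fun n => quotMap₂ B hB n (Hat.proj n z) ∘ₗ Hat.proj n) fun y m n h => by
      rw [LinearMap.comp_apply, LinearMap.comp_apply, ← z.factor_proj h, ← y.factor_proj h]
      obtain ⟨z', hz⟩ := Submodule.Quotient.mk_surjective _ (Hat.proj n z)
      obtain ⟨y', hy⟩ := Submodule.Quotient.mk_surjective _ (Hat.proj n y)
      rw [← hz, ← hy]; rfl)
    (fun a b c => Hat.ext fun n => by simp [Hat.proj_lift])
    (fun t a b => Hat.ext fun n => by simp [Hat.proj_lift])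
    (fun a b c => Hat.ext fun n => by simp [Hat.proj_lift])
    (fun t a b => Hat.ext fun n => by simp [Hat.proj_lift])

theorem Hat.proj_map₂ (B : M →ₗ[R] N →ₗ[R] P) (hB : IsFil₂ B) (z : Hat R M) (y : Hat R N)
    (n : ℕ) : Hat.proj n (Hat.map₂ B hB z y) = quotMap₂ B hB n (Hat.proj n z) (Hat.proj n y) :=
  rfl

end completion
end filtered

section split
variable {k : ℕ}

theorem split_update {i : Fin k → ℕ} {X : Fin (∑ j, i j) → Type v} [∀ n, AddCommGroup (X n)]
    [∀ n, Module R (X n)] [DecidableEq (Fin (∑ j, i j))] (z : ∀ n, X n) (j : Fin k)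
    (m : Fin (i j)) (c : X (finSigmaFinEquiv ⟨j, m⟩)) :
    (fun j' => PiTensorProduct.tprod R fun m' =>
        Function.update z (finSigmaFinEquiv ⟨j, m⟩) c (finSigmaFinEquiv ⟨j', m'⟩))
      = Function.update (fun j' => PiTensorProduct.tprod R fun m' =>
          z (finSigmaFinEquiv ⟨j', m'⟩)) j (PiTensorProduct.tprod R
          (Function.update (fun m' => z (finSigmaFinEquiv ⟨j, m'⟩)) m c)) := by
  funext j'
  by_cases hj : j' = j
  · subst hj
    rw [Function.update_self]
    congr 1
    funext m'
    by_cases hm : m' = m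
    · subst hm; simp
    · rw [Function.update_of_ne hm, Function.update_of_ne]
      simpa using hm
  · rw [Function.update_of_ne hj]
    congr 1
    funext m'
    rw [Function.update_of_ne]
    intro h
    exact hj (congrArg Sigma.fst (finSigmaFinEquiv.injective h))

/-- The canonical map from a tensor product indexed by `Fin (i₁ + ⋯ + i_k)` to the iterated
tensor product over the `k` consecutive blocks of sizes `i₁, …, i_k`. -/
def split (i : Fin k → ℕ) (X : Fin (∑ j, i j) → Type v) [∀ n, AddCommGroup (X n)]
    [∀ n, Module R (X n)] :
    (PiTensorProduct R X) →ₗ[R]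
      PiTensorProduct R fun j => PiTensorProduct R fun m => X (finSigmaFinEquiv ⟨j, m⟩) :=
  PiTensorProduct.lift
    { toFun := fun z => PiTensorProduct.tprod R fun j => PiTensorProduct.tprod R fun m =>
        z (finSigmaFinEquiv ⟨j, m⟩)
      map_update_add' := by
        intro _ z n a b
        obtain ⟨⟨j, m⟩, rfl⟩ := finSigmaFinEquiv.surjective n
        rw [split_update, split_update, split_update, MultilinearMap.map_update_add,
          MultilinearMap.map_update_add]
      map_update_smul' := by
        intro _ z n t b
        obtain ⟨⟨j, m⟩, rfl⟩ := finSigmaFinEquiv.surjective n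
        rw [split_update, split_update, MultilinearMap.map_update_smul,
          MultilinearMap.map_update_smul] }

theorem split_tprod (i : Fin k → ℕ) (X : Fin (∑ j, i j) → Type v) [∀ n, AddCommGroup (X n)]
    [∀ n, Module R (X n)] (z : ∀ n, X n) :
    split (R := R) i X (PiTensorProduct.tprod R z)
      = PiTensorProduct.tprod R fun j => PiTensorProduct.tprod R fun m =>
        z (finSigmaFinEquiv ⟨j, m⟩) := by
  rw [split, PiTensorProduct.lift.tprod]; rfl

theorem isFil_split (i : Fin k → ℕ) (X : Fin (∑ j, i j) → Type v) [∀ n, AddCommGroup (X n)]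
    [∀ n, Module R (X n)] [∀ n, Fil R (X n)] : IsFil (split (R := R) i X) := by
  refine isFil_of_tprod fun d y hy => ?_
  rw [split_tprod]
  refine tprod_mem_fil (fun j => ∑ m, d (finSigmaFinEquiv ⟨j, m⟩))
    (fun j => tprod_mem_fil (fun m => d (finSigmaFinEquiv ⟨j, m⟩)) (fun m => hy _) le_rfl) ?_
  rw [← Equiv.sum_comp finSigmaFinEquiv, Fintype.sum_sigma]

/-- The block permutation induced by a permutation `σ` of `k` blocks of sizes `i₁, …, i_k`. -/
def blockPerm (σ : Equiv.Perm (Fin k)) (i : Fin k → ℕ) :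
    Fin (∑ j, i j) ≃ Fin (∑ j, i (σ.symm j)) :=
  finSigmaFinEquiv.symm.trans ((Equiv.sigmaCongrLeft' σ).trans finSigmaFinEquiv)

/-- The bijection given by bijections inside each of the `k` blocks. -/
def blockSum {i i' : Fin k → ℕ} (τ : ∀ j, Fin (i j) ≃ Fin (i' j)) :
    Fin (∑ j, i j) ≃ Fin (∑ j, i' j) :=
  finSigmaFinEquiv.symm.trans ((Equiv.sigmaCongrRight τ).trans finSigmaFinEquiv)

theorem blockPerm_symm_apply (σ : Equiv.Perm (Fin k)) (i : Fin k → ℕ) (j : Fin k)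
    (m : Fin (i (σ.symm j))) :
    (blockPerm σ i).symm (finSigmaFinEquiv ⟨j, m⟩) = finSigmaFinEquiv ⟨σ.symm j, m⟩ := by
  simp only [blockPerm, Equiv.symm_trans_apply, Equiv.symm_apply_apply, Equiv.symm_symm]
  rfl

theorem blockPerm_apply (σ : Equiv.Perm (Fin k)) (i : Fin k → ℕ) (j : Fin k)
    (m : Fin (i j)) (m' : Fin (i (σ.symm (σ j)))) (hm : (m : ℕ) = m') :
    blockPerm σ i (finSigmaFinEquiv ⟨j, m⟩) = finSigmaFinEquiv ⟨σ j, m'⟩ := by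
  rw [← Equiv.eq_symm_apply, blockPerm_symm_apply]
  congr 1
  refine Sigma.ext (by simp) ?_
  rw [Fin.heq_ext_iff (by simp)]
  exact hm

theorem finSigma_lt {i : Fin k → ℕ} {a b : Fin k} (m : Fin (i a)) (n : Fin (i b)) (h : a < b) :
    finSigmaFinEquiv (⟨a, m⟩ : Σ j, Fin (i j)) < finSigmaFinEquiv ⟨b, n⟩ := by
  rw [Fin.lt_def, finSigmaFinEquiv_apply, finSigmaFinEquiv_apply]
  have key : ∀ c : Fin k, ∑ l : Fin (c : ℕ), i (Fin.castLE c.2.le l)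
      = ∑ l ∈ Finset.univ.filter (fun l : Fin k => l < c), i l := by
    intro c
    refine Finset.sum_bij (fun l _ => Fin.castLE c.2.le l) ?_ ?_ ?_ ?_
    · intro l _; simp only [Finset.mem_filter, Finset.mem_univ, true_and, Fin.lt_def]; exact l.2
    · intro l _ l' _ hl; simpa using hl
    · intro l hl
      simp only [Finset.mem_filter, Finset.mem_univ, true_and] at hl
      exact ⟨⟨l, hl⟩, Finset.mem_univ _, rfl⟩
    · intro l _; rfl
  dsimp only
  rw [key a, key b]
  have hsub : insert a (Finset.univ.filter (fun l : Fin k => l < a))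
      ⊆ Finset.univ.filter (fun l : Fin k => l < b) := by
    intro l hl
    simp only [Finset.mem_insert, Finset.mem_filter, Finset.mem_univ, true_and] at hl ⊢
    rcases hl with rfl | hl
    · exact h
    · exact hl.trans h
  have h1 := Finset.sum_le_sum_of_subset (f := i) hsub
  rw [Finset.sum_insert (by simp)] at h1
  have := m.2
  omega

theorem blockPerm_sign (σ : Equiv.Perm (Fin k)) (i : Fin k → ℕ) (a : Fin (∑ j, i j) → ZMod 2) :
    permSign R (blockPerm σ i) a
      = permSign R σ fun j => ∑ m, a (finSigmaFinEquiv ⟨j, m⟩) := by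
  unfold permSign
  congr 1
  rw [← Equiv.sum_comp finSigmaFinEquiv, Fintype.sum_sigma]
  simp_rw [← Equiv.sum_comp (finSigmaFinEquiv (n := i)), Fintype.sum_sigma]
  have hb : ∀ (j : Fin k) (m : Fin (i j)), blockPerm σ i (finSigmaFinEquiv ⟨j, m⟩)
      = finSigmaFinEquiv ⟨σ j, Fin.cast (by simp) m⟩ :=
    fun j m => blockPerm_apply σ i j m _ rfl
  refine Finset.sum_congr rfl fun j _ => ?_
  rw [Finset.sum_comm]
  refine Finset.sum_congr rfl fun j' _ => ?_
  rw [Finset.sum_mul_sum]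
  rcases lt_trichotomy j j' with hj | rfl | hj
  · by_cases hs : σ j' < σ j
    · rw [if_pos ⟨hj, hs⟩]
      refine Finset.sum_congr rfl fun m _ => Finset.sum_congr rfl fun m' _ => ?_
      rw [hb, hb, if_pos ⟨finSigma_lt _ _ hj, finSigma_lt _ _ hs⟩]
    · rw [if_neg fun h => hs h.2]
      refine Finset.sum_eq_zero fun m _ => Finset.sum_eq_zero fun m' _ => ?_
      have hne : σ j ≠ σ j' := fun h => hj.ne (σ.injective h)
      have hs' : σ j < σ j' := lt_of_le_of_ne (not_lt.mp hs) hne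
      rw [hb, hb, if_neg fun h => (finSigma_lt _ _ hs').not_gt h.2]
  · rw [if_neg fun h => lt_irrefl _ h.1]
    refine Finset.sum_eq_zero fun m _ => Finset.sum_eq_zero fun m' _ => ?_
    rw [hb, hb, if_neg]
    rintro ⟨h1, h2⟩
    rw [Fin.lt_def, finSigmaFinEquiv_apply, finSigmaFinEquiv_apply] at h1 h2
    simp at h1 h2
    omega
  · rw [if_neg fun h => hj.not_gt h.1]
    refine Finset.sum_eq_zero fun m _ => Finset.sum_eq_zero fun m' _ => ?_
    rw [if_neg fun h => (finSigma_lt _ _ hj).not_gt h.1]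

theorem split_permute {M : Type v} [AddCommGroup M] [Module R M] [Parity R M]
    (σ : Equiv.Perm (Fin k)) (i : Fin k → ℕ) :
    split (R := R) (fun j => i (σ.symm j)) (fun _ => M) ∘ₗ permute (blockPerm σ i)
      = permute (R := R) (X := fun j => PiTensorProduct R fun _ : Fin (i j) => M) σ ∘ₗ
        split (R := R) i (fun _ => M) := by
  apply hom_ext_par
  intro a z hz
  simp only [LinearMap.comp_apply]
  rw [permute_tprod _ hz, split_tprod, map_smul, split_tprod,
    permute_tprod (R := R) (a := fun j => ∑ m, a (finSigmaFinEquiv ⟨j, m⟩)) σ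
      (fun j => IsPar.tprod fun m => hz _), blockPerm_sign]
  refine congrArg _ (congrArg _ (funext fun j => congrArg _ (funext fun m => ?_)))
  exact congrArg z (blockPerm_symm_apply σ i j m)

end split

section rearrangements
variable {k : ℕ} {M : Type x} [AddCommGroup M] [Module R M]
  {X : Fin k → Type v} {Y : Fin k → Type w}
  [∀ i, AddCommGroup (X i)] [∀ i, Module R (X i)] [∀ i, Parity R (X i)]
  [∀ i, AddCommGroup (Y i)] [∀ i, Module R (Y i)] [∀ i, Parity R (Y i)]

/-- The rearrangement
`m ⊗ (x₁ ⊗ ⋯ ⊗ x_k) ⊗ (y₁ ⊗ ⋯ ⊗ y_k) ↦ ± m ⊗ (x₁ ⊗ y₁) ⊗ ⋯ ⊗ (x_k ⊗ y_k)`. -/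
def regroup : (M ⊗[R] PiTensorProduct R X) ⊗[R] (PiTensorProduct R Y) →ₗ[R]
    M ⊗[R] PiTensorProduct R fun j => X j ⊗[R] Y j :=
  interleave.lTensor M ∘ₗ (TensorProduct.assoc R M _ _).toLinearMap

/-- `D₁ ⊗ 1 ⊗ ⋯ ⊗ 1 ± 1 ⊗ D₂ ⊗ ⋯ ⊗ 1 ± ⋯ ± 1 ⊗ ⋯ ⊗ 1 ⊗ D_k` for odd maps `D_j`; the sign is
`(-1)^{|x₁| + ⋯ + |x_{j-1}|}` in the `j`-th summand. -/
def piLeibniz (D : ∀ j, X j →ₗ[R] X j) : (PiTensorProduct R X) →ₗ[R] PiTensorProduct R X :=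
  ∑ l : Fin k, PiTensorProduct.map fun j =>
    if j < l then signInvol R else if j = l then D j else LinearMap.id

/-- `δ ⊗ 1 ± 1 ⊗ (D₁ ⊗ 1 ⊗ ⋯ ± ⋯)` on `M ⊗ (X₁ ⊗ ⋯ ⊗ X_k)` for odd maps `δ` and `D_j`. -/
def leibniz [Parity R M] (δ : M →ₗ[R] M) (D : ∀ j, X j →ₗ[R] X j) :
    (M ⊗[R] PiTensorProduct R X) →ₗ[R] M ⊗[R] PiTensorProduct R X :=
  TensorProduct.map δ LinearMap.id + TensorProduct.map (signInvol R) (piLeibniz D)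

/-- The elements of degree `n` in `M ⊗ (X₁ ⊗ ⋯ ⊗ X_k)` for graded modules `M` and `X_j`. -/
def tensorGr (gM : ℤ → Submodule R M) (gX : ∀ j, ℤ → Submodule R (X j)) (n : ℤ) :
    Submodule R (M ⊗[R] PiTensorProduct R X) :=
  Submodule.span R {z | ∃ (p : ℤ) (q : Fin k → ℤ) (m : M) (y : ∀ j, X j),
    m ∈ gM p ∧ (∀ j, y j ∈ gX j (q j)) ∧ p + ∑ j, q j = n ∧ z = m ⊗ₜ PiTensorProduct.tprod R y}

end rearrangements

/-- The parity of a graded module. -/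
@[reducible] def gradingParity {M : Type v} [AddCommGroup M] [Module R M] (gr : ℤ → Submodule R M)
    [DirectSum.Decomposition gr] : Parity R M where
  odd := DirectSum.toModule R ℤ M (fun n => if Odd n then (gr n).subtype else 0) ∘ₗ
    (DirectSum.decomposeLinearEquiv gr).toLinearMap
  odd_odd := by
    have h : ∀ (n : ℤ) (z : gr n), DirectSum.toModule R ℤ M
        (fun n => if Odd n then (gr n).subtype else 0) (DirectSum.decompose gr (z : M))
        = if Odd n then (z : M) else 0 := by
      intro n z
      rw [DirectSum.decompose_coe, ← DirectSum.lof_eq_of R, DirectSum.toModule_lof]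
      split_ifs <;> rfl
    ext z
    refine DirectSum.Decomposition.inductionOn gr (by simp) (fun {n} y => ?_) (fun a b ha hb => ?_) z
    · simp only [LinearMap.comp_apply, LinearEquiv.coe_coe, DirectSum.decomposeLinearEquiv_apply]
      rw [h]
      split_ifs with hn
      · rw [h, if_pos hn]
      · simp
    · rw [map_add, ha, hb, map_add]

/-- A symmetric sequence of chain complexes of `R`-modules, with homological grading: for every
arity `r` a graded module `obj r` with a differential `d r` of degree `-1` and an action of the
symmetric group on `r` letters.  The actions are given as a functor on the groupoid of the finite
sets `Fin r` and bijections. -/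
structure DGSymSeq (R : Type u) [CommRing R] where
  obj : ℕ → Type v
  [addCommGroup : ∀ r, AddCommGroup (obj r)]
  [module : ∀ r, Module R (obj r)]
  /-- The part of degree `n` in arity `r`. -/
  gr : ∀ r, ℤ → Submodule R (obj r)
  [decomposition : ∀ r, DirectSum.Decomposition (gr r)]
  act : ∀ {a b : ℕ}, (Fin a ≃ Fin b) → obj a →ₗ[R] obj b
  act_refl : ∀ a (c : obj a), act (Equiv.refl (Fin a)) c = c
  act_trans : ∀ {a b c : ℕ} (e : Fin a ≃ Fin b) (f : Fin b ≃ Fin c) (z : obj a),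
    act (e.trans f) z = act f (act e z)
  act_gr : ∀ {a b : ℕ} (e : Fin a ≃ Fin b) n z, z ∈ gr a n → act e z ∈ gr b n
  d : ∀ r, obj r →ₗ[R] obj r
  d_gr : ∀ r n z, z ∈ gr r n → d r z ∈ gr r (n - 1)
  d_d : ∀ r z, d r (d r z) = 0
  d_act : ∀ {a b : ℕ} (e : Fin a ≃ Fin b) z, d b (act e z) = act e (d a z)

attribute [instance] DGSymSeq.addCommGroup DGSymSeq.module DGSymSeq.decomposition

instance (C : DGSymSeq.{u, v} R) (r : ℕ) : Parity R (C.obj r) := gradingParity (C.gr r)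

theorem DGSymSeq.act_even (C : DGSymSeq.{u, v} R) {a b : ℕ} (e : Fin a ≃ Fin b) :
    IsEven (C.act e) := by
  have h : ∀ (r : ℕ) (n : ℤ) (z : C.obj r), z ∈ C.gr r n →
      Parity.odd (R := R) z = if Odd n then z else 0 := by
    intro r n z hz
    lift z to C.gr r n using hz
    simp only [Parity.odd, LinearMap.comp_apply, LinearEquiv.coe_coe,
      DirectSum.decomposeLinearEquiv_apply]
    rw [DirectSum.decompose_coe, ← DirectSum.lof_eq_of R, DirectSum.toModule_lof]
    split_ifs <;> rfl
  have key : ∀ z, Parity.odd (R := R) (C.act e z) = C.act e (Parity.odd (R := R) z) := by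
    intro z
    refine DirectSum.Decomposition.inductionOn (C.gr a) (by simp) (fun {n} y => ?_)
      (fun a b ha hb => ?_) z
    · rw [h a n y y.2, h b n _ (C.act_gr e n y y.2)]
      split_ifs <;> simp
    · simp only [map_add, ha, hb]
  intro f z hz
  unfold IsPar par at hz ⊢
  split_ifs at hz ⊢
  · rw [key, hz]
  · rw [LinearMap.sub_apply, key]
    conv_rhs => rw [← hz]
    simp

/-- The action of the symmetric group on `r` letters in arity `r`, as a representation. -/
def DGSymSeq.rep (C : DGSymSeq.{u, v} R) (r : ℕ) :
    Representation R (Equiv.Perm (Fin r)) (C.obj r) where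
  toFun σ := C.act σ
  map_one' := by ext z; exact C.act_refl r z
  map_mul' σ τ := by ext z; exact C.act_trans τ σ z

/-- The structure of a (differential graded) cooperad on a symmetric sequence. -/
structure Cooperad {R : Type u} [CommRing R] (S : DGSymSeq.{u, v} R) where
  counit : S.obj 1 →ₗ[R] R
  counit_gr : ∀ n z, n ≠ 0 → z ∈ S.gr 1 n → counit z = 0
  counit_d : ∀ z, counit (S.d 1 z) = 0
  /-- The decomposition map `C(i₁ + ⋯ + i_k) → C(k) ⊗ C(i₁) ⊗ ⋯ ⊗ C(i_k)`. -/
  decomp : ∀ {k : ℕ} (i : Fin k → ℕ),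
    S.obj (∑ j, i j) →ₗ[R] S.obj k ⊗[R] PiTensorProduct R fun j => S.obj (i j)
  decomp_gr : ∀ {k : ℕ} (i : Fin k → ℕ) n z, z ∈ S.gr _ n →
    decomp i z ∈ tensorGr (S.gr k) (fun j => S.gr (i j)) n
  decomp_d : ∀ {k : ℕ} (i : Fin k → ℕ) z,
    decomp i (S.d _ z) = leibniz (S.d k) (fun j => S.d (i j)) (decomp i z)
  decomp_blockSum : ∀ {k : ℕ} (i i' : Fin k → ℕ) (τ : ∀ j, Fin (i j) ≃ Fin (i' j)) z,
    decomp i' (S.act (blockSum τ) z)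
      = TensorProduct.map LinearMap.id (PiTensorProduct.map fun j => S.act (τ j)) (decomp i z)
  decomp_blockPerm : ∀ {k : ℕ} (σ : Equiv.Perm (Fin k)) (i : Fin k → ℕ) z,
    decomp (fun j => i (σ.symm j)) (S.act (blockPerm σ i) z)
      = TensorProduct.map (S.act σ) (permute (X := fun j => S.obj (i j)) σ) (decomp i z)
  /-- Coassociativity. -/
  decomp_decomp : ∀ {k : ℕ} (i : Fin k → ℕ) (l : Fin (∑ j, i j) → ℕ)
    (h : ∑ j, ∑ m, l (finSigmaFinEquiv ⟨j, m⟩) = ∑ n, l n)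
    (z : S.obj (∑ j, ∑ m, l (finSigmaFinEquiv ⟨j, m⟩))),
    TensorProduct.map LinearMap.id (PiTensorProduct.map fun j =>
        decomp fun m => l (finSigmaFinEquiv ⟨j, m⟩))
        (decomp (fun j => ∑ m, l (finSigmaFinEquiv ⟨j, m⟩)) z)
      = regroup (TensorProduct.map (decomp i) (split i fun n => S.obj (l n))
          (decomp l (S.act (finCongr h) z)))
  counit_left : ∀ (r : ℕ) (h : r = ∑ _j : Fin 1, r) (z : S.obj r),
    TensorProduct.lid R (S.obj r) (TensorProduct.map counit
      (PiTensorProduct.subsingletonEquiv (R := R) (s := fun _ : Fin 1 => S.obj r) 0).toLinearMap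
        (decomp (fun _ : Fin 1 => r) (S.act (finCongr h) z))) = z
  counit_right : ∀ (r : ℕ) (h : r = ∑ _j : Fin r, 1) (z : S.obj r),
    TensorProduct.rid R (S.obj r) (TensorProduct.map LinearMap.id
      (PiTensorProduct.lift
        ((MultilinearMap.mkPiAlgebra R (Fin r) R).compLinearMap fun _ => counit))
        (decomp (fun _ : Fin r => 1) (S.act (finCongr h) z))) = z

/-- A unital Hopf cooperad, i.e. a cooperad in unital associative algebras, that is unitary
(`C(0) = R`, spanned by the unitary operation `unit 0`) and reduced (`C(1) = R` through the
counit). -/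
structure HopfCooperad (R : Type u) [CommRing R] where
  S : DGSymSeq.{u, v} R
  C : Cooperad S
  mul : ∀ r, S.obj r ⊗[R] S.obj r →ₗ[R] S.obj r
  /-- The units `η_r ∈ C(r)`. -/
  unit : ∀ r, S.obj r
  mul_assoc : ∀ r (a b c : S.obj r), mul r (mul r (a ⊗ₜ b) ⊗ₜ c) = mul r (a ⊗ₜ mul r (b ⊗ₜ c))
  unit_mul : ∀ r (a : S.obj r), mul r (unit r ⊗ₜ a) = a
  mul_unit : ∀ r (a : S.obj r), mul r (a ⊗ₜ unit r) = a
  mul_gr : ∀ r m n (a b : S.obj r), a ∈ S.gr r m → b ∈ S.gr r n → mul r (a ⊗ₜ b) ∈ S.gr r (m + n)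
  unit_gr : ∀ r, unit r ∈ S.gr r 0
  d_mul : ∀ r (a b : S.obj r),
    S.d r (mul r (a ⊗ₜ b)) = mul r (S.d r a ⊗ₜ b) + mul r (signInvol R a ⊗ₜ S.d r b)
  d_unit : ∀ r, S.d r (unit r) = 0
  act_mul : ∀ {r s : ℕ} (e : Fin r ≃ Fin s) (a b : S.obj r),
    S.act e (mul r (a ⊗ₜ b)) = mul s (S.act e a ⊗ₜ S.act e b)
  act_unit : ∀ {r s : ℕ} (e : Fin r ≃ Fin s), S.act e (unit r) = unit s
  /-- The decomposition maps are morphisms of unital algebras. -/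
  decomp_mul : ∀ {k : ℕ} (i : Fin k → ℕ) (a b : S.obj (∑ j, i j)),
    C.decomp i (mul _ (a ⊗ₜ b)) = TensorProduct.map (mul k)
      (PiTensorProduct.map (fun j => mul (i j)) ∘ₗ interleave)
      (middleSwap (C.decomp i a ⊗ₜ[R] C.decomp i b))
  decomp_unit : ∀ {k : ℕ} (i : Fin k → ℕ),
    C.decomp i (unit _) = unit k ⊗ₜ PiTensorProduct.tprod R fun j => unit (i j)
  counit_mul : ∀ a b, C.counit (mul 1 (a ⊗ₜ b)) = C.counit a * C.counit b
  counit_unit : C.counit (unit 1) = 1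
  unitary : Function.Bijective fun t : R => t • unit 0
  reduced : Function.Bijective C.counit

/-- The arity `r` part of a Hopf cooperad. -/
abbrev HopfCooperad.obj (C : HopfCooperad.{u, v} R) (r : ℕ) : Type v := C.S.obj r

/-- The identification `C(0) = R` that takes the unitary operation to `1`. -/
def HopfCooperad.arityZero (C : HopfCooperad.{u, v} R) : C.obj 0 ≃ₗ[R] R :=
  (LinearEquiv.ofBijective (LinearMap.toSpanSingleton R (C.obj 0) (C.unit 0)) C.unitary).symm

/-- A graded `R`-module with a complete descending filtration
`V = F¹V ⊇ F²V ⊇ ⋯` by graded submodules. -/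
structure CompleteGradedModule (R : Type u) [CommRing R] where
  carrier : Type w
  [addCommGroup : AddCommGroup carrier]
  [module : Module R carrier]
  gr : ℤ → Submodule R carrier
  [decomposition : DirectSum.Decomposition gr]
  fil : ℕ → Submodule R carrier
  fil_anti : Antitone fil
  fil_one : fil 1 = ⊤
  /-- The `FⁿV` are graded submodules. -/
  fil_graded : ∀ n z, z ∈ fil n → ∀ p : ℤ, (DirectSum.decompose gr z p : carrier) ∈ fil n
  separated : ⨅ n, fil n = ⊥
  /-- Every Cauchy sequence of elements of the same degree converges. -/
  complete : ∀ (p : ℤ) (z : ℕ → carrier), (∀ n, z n ∈ gr p) →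
    (∀ n, z (n + 1) - z n ∈ fil n) → ∃ y ∈ gr p, ∀ n, y - z n ∈ fil n

attribute [instance] CompleteGradedModule.addCommGroup CompleteGradedModule.module
  CompleteGradedModule.decomposition

instance (V : CompleteGradedModule.{u, w} R) : Parity R V.carrier := gradingParity V.gr

instance (V : CompleteGradedModule.{u, w} R) : Fil R V.carrier where
  fil := V.fil
  anti := V.fil_anti
  zero := top_unique (V.fil_one ▸ V.fil_anti (Nat.zero_le 1))

instance (V : CompleteGradedModule.{u, w} R) : FilPar R V.carrier where
  odd_fil := by
    intro n z hz
    classical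
    have : Parity.odd (R := R) z = ∑ p ∈ (DirectSum.decompose V.gr z).support,
        if Odd p then (DirectSum.decompose V.gr z p : V.carrier) else 0 := by
      conv_lhs => rw [← DirectSum.sum_support_decompose V.gr z]
      rw [map_sum]
      refine Finset.sum_congr rfl fun p _ => ?_
      simp only [Parity.odd, LinearMap.comp_apply, LinearEquiv.coe_coe,
        DirectSum.decomposeLinearEquiv_apply]
      rw [DirectSum.decompose_coe, ← DirectSum.lof_eq_of R, DirectSum.toModule_lof]
      split_ifs <;> rfl
    rw [this]
    refine Submodule.sum_mem _ fun p _ => ?_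
    split_ifs
    · exact V.fil_graded n z hz p
    · exact Submodule.zero_mem _

section cofree

section auxiliary
variable {M N : Type*} [AddCommGroup M] [Module R M] [AddCommGroup N] [Module R N]

theorem isEven_of_odd [Parity R M] [Parity R N] {f : M →ₗ[R] N}
    (h : ∀ z, Parity.odd (R := R) (f z) = f (Parity.odd (R := R) z)) : IsEven f := by
  intro e z hz
  unfold IsPar par at hz ⊢
  split_ifs at hz ⊢
  · rw [h, hz]
  · rw [LinearMap.sub_apply, h]
    conv_rhs => rw [← hz]
    simp

theorem IsEven.odd_apply [Parity R M] [Parity R N] {f : M →ₗ[R] N} (hf : IsEven f) (z : M) :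
    Parity.odd (R := R) (f z) = f (Parity.odd (R := R) z) := by
  simpa [par] using hf.par_apply 1 z

theorem IsEven.tensorMap {M' N' : Type*} [AddCommGroup M'] [Module R M'] [AddCommGroup N']
    [Module R N'] [Parity R M] [Parity R N] [Parity R M'] [Parity R N']
    {f : M →ₗ[R] M'} {g : N →ₗ[R] N'} (hf : IsEven f) (hg : IsEven g) :
    IsEven (TensorProduct.map f g) := by
  apply isEven_of_odd
  intro z
  induction z using TensorProduct.induction_on with
  | zero => simp
  | tmul m n => simp [Parity.odd, hf.par_apply, hg.par_apply]
  | add a b ha hb => simp only [map_add, ha, hb]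

variable {k : ℕ} {X : Fin k → Type v} {Y : Fin k → Type w}
  [∀ i, AddCommGroup (X i)] [∀ i, Module R (X i)] [∀ i, Parity R (X i)]
  [∀ i, AddCommGroup (Y i)] [∀ i, Module R (Y i)] [∀ i, Parity R (Y i)]

theorem isFil_assoc {P : Type x} [AddCommGroup P] [Module R P] [Fil R P] :
    IsFil (TensorProduct.assoc R M N P).toLinearMap := by
  refine isFil_of_tmul fun n z y hy => ?_
  induction z using TensorProduct.induction_on with
  | zero => simp
  | tmul a b =>
    rw [LinearEquiv.coe_coe, TensorProduct.assoc_tmul]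
    exact tmul_mem_fil _ (tmul_mem_fil _ hy)
  | add a b ha hb =>
    rw [TensorProduct.add_tmul, map_add]; exact Submodule.add_mem _ ha hb

theorem isFil_regroup [∀ i, Fil R (Y i)] [∀ i, FilPar R (Y i)] :
    IsFil (regroup (R := R) (M := M) (X := X) (Y := Y)) :=
  (IsFil.tensorMap LinearMap.id isFil_interleave).comp isFil_assoc

theorem regroup_permute (f : M →ₗ[R] N) (e : Equiv.Perm (Fin k))
    (z : (M ⊗[R] PiTensorProduct R X) ⊗[R] (PiTensorProduct R Y)) :
    regroup (TensorProduct.map (TensorProduct.map f (permute e)) (permute e) z)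
      = TensorProduct.map f (permute e) (regroup z) := by
  induction z using TensorProduct.induction_on with
  | zero => simp
  | add a b ha hb => simp only [map_add, ha, hb]
  | tmul a y =>
    induction a using TensorProduct.induction_on with
    | zero => simp
    | add a b ha hb => simp only [TensorProduct.add_tmul, map_add, ha, hb]
    | tmul m z =>
      have h := congrArg (fun g => g (z ⊗ₜ[R] y))
        (permute_interleave (R := R) (X := X) (Y := Y) e)
      simp only [LinearMap.comp_apply, TensorProduct.map_tmul] at h
      simp [regroup, h]

theorem isFil_leibniz [∀ i, Fil R (X i)] [∀ i, FilPar R (X i)] [Parity R M] (δ : M →ₗ[R] M)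
    {D : ∀ j, X j →ₗ[R] X j} (hD : ∀ j, IsFil (D j)) : IsFil (leibniz δ D) := by
  refine (IsFil.tensorMap _ IsFil.id).add (IsFil.tensorMap _ (IsFil.sum fun l _ => ?_))
  refine IsFil.piMap fun j => ?_
  split_ifs
  · exact isFil_signInvol
  · exact hD j
  · exact IsFil.id

/-- Filteredness of `y ↦ t₁(x₁,y₁) ⊗ ⋯ ⊗ t_k(x_k,y_k)`, with signs. -/
theorem interleave_mem_left {Z : Type x} [AddCommGroup Z] [Module R Z] [Fil R Z]
    [∀ i, Fil R (X i)] [∀ i, FilPar R (X i)] {t : ∀ j, X j ⊗[R] Y j →ₗ[R] Z}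
    (ht : ∀ j n z y, z ∈ Fil.fil (R := R) n → t j (z ⊗ₜ y) ∈ Fil.fil (R := R) n)
    (n : ℕ) (z : PiTensorProduct R X) (hz : z ∈ Fil.fil (R := R) n) (y : PiTensorProduct R Y) :
    PiTensorProduct.map t (interleave (z ⊗ₜ[R] y)) ∈ Fil.fil (R := R) n := by
  induction y using PiTensorProduct.induction_on with
  | smul_tprod r y =>
    rw [TensorProduct.tmul_smul, map_smul, map_smul]
    refine Submodule.smul_mem _ _ ?_
    revert n z
    refine isFil_of_tprod (f := PiTensorProduct.map t ∘ₗ interleave ∘ₗ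
      (TensorProduct.mk R _ _).flip (PiTensorProduct.tprod R y)) fun d z hz => ?_
    simp only [LinearMap.comp_apply, LinearMap.flip_apply, TensorProduct.mk_apply]
    rw [interleave_apply_tprod]
    simp only [map_sum, map_smul, PiTensorProduct.map_tprod]
    refine Submodule.sum_mem _ fun a _ => Submodule.sum_mem _ fun b _ => Submodule.smul_mem _ _ ?_
    exact tprod_mem_fil d (fun j => ht j _ _ _ (isFil_par _ _ _ (hz j))) le_rfl
  | add a b ha hb =>
    rw [TensorProduct.tmul_add, map_add, map_add]; exact Submodule.add_mem _ ha hb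

theorem interleave_mem_right {Z : Type x} [AddCommGroup Z] [Module R Z] [Fil R Z]
    [∀ i, Fil R (Y i)] [∀ i, FilPar R (Y i)] {t : ∀ j, X j ⊗[R] Y j →ₗ[R] Z}
    (ht : ∀ j n z y, y ∈ Fil.fil (R := R) n → t j (z ⊗ₜ y) ∈ Fil.fil (R := R) n)
    (n : ℕ) (z : PiTensorProduct R X) (y : PiTensorProduct R Y) (hy : y ∈ Fil.fil (R := R) n) :
    PiTensorProduct.map t (interleave (z ⊗ₜ[R] y)) ∈ Fil.fil (R := R) n := by
  have h1 : interleave (z ⊗ₜ[R] y) ∈ Fil.fil (R := R)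
      (M := PiTensorProduct R fun j => X j ⊗[R] Y j) n :=
    isFil_interleave n _ (tmul_mem_fil z hy)
  refine IsFil.piMap (fun j => ?_) n _ h1
  exact isFil_of_tmul fun n m y hy => ht j n m y hy

/-- The product `(m ⊗ x) (m' ⊗ y) = ± μ(m,m') ⊗ t₁(x₁,y₁) ⊗ ⋯ ⊗ t_k(x_k,y_k)`. -/
def pairing {Z : Type x} [AddCommGroup Z] [Module R Z] [Parity R M]
    (μ : M ⊗[R] M →ₗ[R] M) (t : ∀ j, X j ⊗[R] Y j →ₗ[R] Z) :
    (M ⊗[R] PiTensorProduct R X) ⊗[R] (M ⊗[R] PiTensorProduct R Y) →ₗ[R]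
      M ⊗[R] PiTensorProduct R fun _ : Fin k => Z :=
  TensorProduct.map μ (PiTensorProduct.map t ∘ₗ interleave) ∘ₗ middleSwap

theorem pairing_tmul {Z : Type x} [AddCommGroup Z] [Module R Z] [Parity R M]
    (μ : M ⊗[R] M →ₗ[R] M) (t : ∀ j, X j ⊗[R] Y j →ₗ[R] Z) (m m' : M)
    (z : PiTensorProduct R X) (y : PiTensorProduct R Y) :
    pairing μ t ((m ⊗ₜ z) ⊗ₜ (m' ⊗ₜ y)) = ∑ a : ZMod 2, ∑ b : ZMod 2, sg R (a * b) •
      (μ (m ⊗ₜ par R b m') ⊗ₜ PiTensorProduct.map t (interleave (par R a z ⊗ₜ[R] y))) := by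
  simp [pairing, middleSwap, map_sum]

theorem pairing_mem_left {Z : Type x} [AddCommGroup Z] [Module R Z] [Fil R Z] [Parity R M]
    [∀ i, Fil R (X i)] [∀ i, FilPar R (X i)] (μ : M ⊗[R] M →ₗ[R] M)
    {t : ∀ j, X j ⊗[R] Y j →ₗ[R] Z}
    (ht : ∀ j n z y, z ∈ Fil.fil (R := R) n → t j (z ⊗ₜ y) ∈ Fil.fil (R := R) n)
    (n : ℕ) (z : M ⊗[R] PiTensorProduct R X) (y : M ⊗[R] PiTensorProduct R Y)
    (hz : z ∈ Fil.fil (R := R) n) : pairing μ t (z ⊗ₜ y) ∈ Fil.fil (R := R) n := by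
  induction y using TensorProduct.induction_on with
  | zero => simp
  | add a b ha hb => rw [TensorProduct.tmul_add, map_add]; exact Submodule.add_mem _ ha hb
  | tmul m' y =>
    revert n z
    refine isFil_of_tmul (f := pairing μ t ∘ₗ (TensorProduct.mk R _ _).flip (m' ⊗ₜ y))
      fun n m z hz => ?_
    simp only [LinearMap.comp_apply, LinearMap.flip_apply, TensorProduct.mk_apply]
    rw [pairing_tmul]
    refine Submodule.sum_mem _ fun a _ => Submodule.sum_mem _ fun b _ => Submodule.smul_mem _ _ ?_
    exact tmul_mem_fil _ (interleave_mem_left ht n _ (isFil_par _ _ _ hz) _)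

theorem pairing_mem_right {Z : Type x} [AddCommGroup Z] [Module R Z] [Fil R Z] [Parity R M]
    [∀ i, Fil R (Y i)] [∀ i, FilPar R (Y i)] (μ : M ⊗[R] M →ₗ[R] M)
    {t : ∀ j, X j ⊗[R] Y j →ₗ[R] Z}
    (ht : ∀ j n z y, y ∈ Fil.fil (R := R) n → t j (z ⊗ₜ y) ∈ Fil.fil (R := R) n)
    (n : ℕ) (z : M ⊗[R] PiTensorProduct R X) (y : M ⊗[R] PiTensorProduct R Y)
    (hy : y ∈ Fil.fil (R := R) n) : pairing μ t (z ⊗ₜ y) ∈ Fil.fil (R := R) n := by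
  induction z using TensorProduct.induction_on with
  | zero => simp
  | add a b ha hb => rw [TensorProduct.add_tmul, map_add]; exact Submodule.add_mem _ ha hb
  | tmul m z =>
    revert n y
    refine isFil_of_tmul (f := pairing μ t ∘ₗ TensorProduct.mk R _ _ (m ⊗ₜ z))
      fun n m' y hy => ?_
    simp only [LinearMap.comp_apply, TensorProduct.mk_apply]
    rw [pairing_tmul]
    refine Submodule.sum_mem _ fun a _ => Submodule.sum_mem _ fun b _ => Submodule.smul_mem _ _ ?_
    exact tmul_mem_fil _ (interleave_mem_right ht n _ _ hy)

theorem pairing_permute {Z : Type x} [AddCommGroup Z] [Module R Z] [Parity R M] [Parity R Z]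
    (μ : M ⊗[R] M →ₗ[R] M) {t : ∀ j, X j ⊗[R] Y j →ₗ[R] Z} (ht : ∀ j, IsEven (t j))
    (e : Equiv.Perm (Fin k)) (f : M →ₗ[R] M) (hf : IsEven f)
    (hμ : ∀ a b, f (μ (a ⊗ₜ b)) = μ (f a ⊗ₜ f b))
    (z : M ⊗[R] PiTensorProduct R X) (y : M ⊗[R] PiTensorProduct R Y) :
    TensorProduct.map f (permute e) (pairing μ t (z ⊗ₜ y))
      = pairing μ (fun j => t (e.symm j))
        (TensorProduct.map f (permute e) z ⊗ₜ TensorProduct.map f (permute e) y) := by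
  induction z using TensorProduct.induction_on with
  | zero => simp
  | add a b ha hb => simp only [TensorProduct.add_tmul, map_add, ha, hb]
  | tmul m z =>
    induction y using TensorProduct.induction_on with
    | zero => simp
    | add a b ha hb => simp only [TensorProduct.tmul_add, map_add, ha, hb]
    | tmul m' y =>
      have h1 : ∀ z : PiTensorProduct R X,
          permute e (PiTensorProduct.map t (interleave (z ⊗ₜ[R] y)))
          = PiTensorProduct.map (fun j => t (e.symm j))
            (interleave (permute e z ⊗ₜ[R] permute e y)) := by
        intro z
        have h2 := congrArg (fun g => g (interleave (z ⊗ₜ[R] y)))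
          (permute_map (R := R) (X := fun j => X j ⊗[R] Y j) (Y := fun _ => Z) e ht)
        have h3 := congrArg (fun g => g (z ⊗ₜ[R] y))
          (permute_interleave (R := R) (X := X) (Y := Y) e)
        simp only [LinearMap.comp_apply, TensorProduct.map_tmul] at h2 h3
        rw [h2, h3]
      simp only [TensorProduct.map_tmul]
      rw [pairing_tmul, pairing_tmul]
      simp only [map_sum, map_smul, TensorProduct.map_tmul, h1, hμ, hf.par_apply,
        (permute_even e).par_apply]

end auxiliary

variable (C : HopfCooperad.{u, v} R) (V : CompleteGradedModule.{u, w} R)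

/-- The graded module `C(r) ⊗ V^{⊗ r}`, with the filtration induced by that of `V`. -/
abbrev Word (r : ℕ) : Type max u v w := C.obj r ⊗[R] PiTensorProduct R fun _ : Fin r => V.carrier

/-- The diagonal action of permutations on `C(r) ⊗ V^{⊗ r}`. -/
def wordAct {a b : ℕ} (e : Fin a ≃ Fin b) : Word C V a →ₗ[R] Word C V b :=
  TensorProduct.map (C.S.act e) (permute e)

theorem isFil_wordAct {a b : ℕ} (e : Fin a ≃ Fin b) : IsFil (wordAct C V e) :=
  IsFil.tensorMap _ (isFil_permute e)

theorem wordAct_even {a b : ℕ} (e : Fin a ≃ Fin b) : IsEven (wordAct C V e) :=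
  (C.S.act_even e).tensorMap (permute_even e)

/-- The submodule of invariant families in the product of the completions of the
`C(r) ⊗ V^{⊗ r}`. -/
def cofreeSubmodule : Submodule R (∀ r, Hat R (Word C V r)) where
  carrier := {z | ∀ (a b : ℕ) (e : Fin a ≃ Fin b),
    Hat.map (wordAct C V e) (isFil_wordAct C V e) (z a) = z b}
  zero_mem' := fun a b e => by simp
  add_mem' := fun {x y} hx hy a b e => by simp only [Pi.add_apply, map_add, hx a b e, hy a b e]
  smul_mem' := fun t x hx a b e => by simp only [Pi.smul_apply, map_smul, hx a b e]

/-- The completed cofree coalgebra `uC(V)`, i.e. the product over all `r ≥ 0` of the invariants of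
the symmetric group in the completion of `C(r) ⊗ V^{⊗ r}`.  (When `C(r)` is free over the group
ring, or when `R` contains the rational numbers, the norm map identifies the coinvariants with the
invariants.)  It is a complete filtered module, topologically spanned by its homogeneous
elements. -/
def Cofree : Type max u v w := cofreeSubmodule C V

instance : AddCommGroup (Cofree C V) := inferInstanceAs (AddCommGroup (cofreeSubmodule C V))

instance : Module R (Cofree C V) := inferInstanceAs (Module R (cofreeSubmodule C V))

/-- The projection to the arity `r` part. -/
def cofreeProj (r : ℕ) : Cofree C V →ₗ[R] Hat R (Word C V r) :=
  LinearMap.proj r ∘ₗ (cofreeSubmodule C V).subtype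

variable {C V} in
theorem Cofree.ext {x y : Cofree C V} (h : ∀ r, cofreeProj C V r x = cofreeProj C V r y) :
    x = y :=
  Subtype.ext (funext h)

variable {C V} in
theorem Cofree.act_proj (x : Cofree C V) {a b : ℕ} (e : Fin a ≃ Fin b) :
    Hat.map (wordAct C V e) (isFil_wordAct C V e) (cofreeProj C V a x) = cofreeProj C V b x :=
  x.2 a b e

/-- Linear maps to `uC(V)` from invariant families of linear maps. -/
def cofreeLift {P : Type x} [AddCommGroup P] [Module R P] (f : ∀ r, P →ₗ[R] Hat R (Word C V r))
    (h : ∀ z (a b : ℕ) (e : Fin a ≃ Fin b),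
      Hat.map (wordAct C V e) (isFil_wordAct C V e) (f a z) = f b z) : P →ₗ[R] Cofree C V :=
  LinearMap.codRestrict (cofreeSubmodule C V) (LinearMap.pi f) h

theorem cofreeProj_lift {P : Type x} [AddCommGroup P] [Module R P]
    (f : ∀ r, P →ₗ[R] Hat R (Word C V r))
    (h : ∀ z (a b : ℕ) (e : Fin a ≃ Fin b),
      Hat.map (wordAct C V e) (isFil_wordAct C V e) (f a z) = f b z) (z : P) (r : ℕ) :
    cofreeProj C V r (cofreeLift C V f h z) = f r z := rfl

instance cofreeFil : Fil R (Cofree C V) where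
  fil n := ⨅ r, (Fil.fil (R := R) n).comap (cofreeProj C V r)
  anti := fun _ _ h => iInf_mono fun _ => Submodule.comap_mono (Fil.anti h)
  zero := by simp [Fil.zero]

variable {C V} in
theorem mem_cofreeFil {n : ℕ} {x : Cofree C V} :
    x ∈ Fil.fil (R := R) n ↔ ∀ r, cofreeProj C V r x ∈ Fil.fil (R := R) n := by
  change x ∈ ⨅ r, (Fil.fil (R := R) n).comap (cofreeProj C V r) ↔ _
  rw [Submodule.mem_iInf]; rfl

theorem isFil_cofreeProj (r : ℕ) : IsFil (cofreeProj C V r) :=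
  fun _ _ hz => mem_cofreeFil.mp hz r

instance cofreeParity : Parity R (Cofree C V) where
  odd := cofreeLift C V (fun r => Hat.map Parity.odd FilPar.odd_fil ∘ₗ cofreeProj C V r)
    fun z a b e => by
      rw [LinearMap.comp_apply, LinearMap.comp_apply, ← z.act_proj e, Hat.map_map, Hat.map_map]
      have : wordAct C V e ∘ₗ Parity.odd (R := R) = Parity.odd (R := R) ∘ₗ wordAct C V e :=
        LinearMap.ext fun z => ((wordAct_even C V e).odd_apply z).symm
      simp only [this]
  odd_odd := by
    apply LinearMap.ext
    intro z
    apply Cofree.ext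
    intro r
    rw [LinearMap.comp_apply, cofreeProj_lift, cofreeProj_lift, LinearMap.comp_apply,
      LinearMap.comp_apply, cofreeProj_lift, LinearMap.comp_apply, Hat.map_map]
    simp only [Parity.odd_odd]

instance : FilPar R (Cofree C V) where
  odd_fil := fun n z hz => by
    rw [mem_cofreeFil] at hz ⊢
    exact fun r => isFil_hatMap Parity.odd FilPar.odd_fil n _ (hz r)

variable {k : ℕ}

/-- The decomposition `C(i₁ + ⋯ + i_k) ⊗ V^{⊗ (i₁ + ⋯ + i_k)} →
C(k) ⊗ (C(i₁) ⊗ V^{⊗ i₁}) ⊗ ⋯ ⊗ (C(i_k) ⊗ V^{⊗ i_k})` induced by that of the cooperad. -/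
def wordDecomp (i : Fin k → ℕ) : Word C V (∑ j, i j) →ₗ[R]
    C.obj k ⊗[R] PiTensorProduct R fun j => Word C V (i j) :=
  regroup ∘ₗ TensorProduct.map (C.C.decomp i) (split i fun _ => V.carrier)

theorem isFil_wordDecomp (i : Fin k → ℕ) : IsFil (wordDecomp C V i) :=
  isFil_regroup.comp (IsFil.tensorMap _ (isFil_split i _))

theorem wordDecomp_act (σ : Equiv.Perm (Fin k)) (i : Fin k → ℕ) (z : Word C V (∑ j, i j)) :
    wordDecomp C V (fun j => i (σ.symm j)) (wordAct C V (blockPerm σ i) z)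
      = TensorProduct.map (C.S.act σ) (permute (X := fun j => Word C V (i j)) σ)
        (wordDecomp C V i z) := by
  have h : TensorProduct.map (C.C.decomp fun j => i (σ.symm j))
      (split (R := R) (fun j => i (σ.symm j)) fun _ => V.carrier) (wordAct C V (blockPerm σ i) z)
      = TensorProduct.map (TensorProduct.map (C.S.act σ)
          (permute (R := R) (X := fun j => C.obj (i j)) σ))
        (permute (R := R) (X := fun j => PiTensorProduct R fun _ : Fin (i j) => V.carrier) σ)
        (TensorProduct.map (C.C.decomp i) (split (R := R) i fun _ => V.carrier) z) := by
    induction z using TensorProduct.induction_on with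
    | zero => simp
    | add a b ha hb => simp only [map_add, ha, hb]
    | tmul c y =>
      have h := congrArg (fun g => g y) (split_permute (R := R) (M := V.carrier) σ i)
      simp only [LinearMap.comp_apply] at h
      simp only [wordAct, TensorProduct.map_tmul]
      rw [C.C.decomp_blockPerm]
      exact congrArg _ h
  unfold wordDecomp
  rw [LinearMap.comp_apply, LinearMap.comp_apply]
  refine (congrArg _ h).trans ?_
  exact regroup_permute (R := R) (M := C.obj k) (N := C.obj k) (X := fun j => C.obj (i j))
    (Y := fun j => PiTensorProduct R fun _ : Fin (i j) => V.carrier) (C.S.act σ) σ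
    (TensorProduct.map (C.C.decomp i) (split (R := R) i fun _ => V.carrier) z)

/-- The `(i₁, …, i_k)`-component of the decomposition, on completions. -/
def hatDecomp (i : Fin k → ℕ) : Hat R (Word C V (∑ j, i j)) →ₗ[R]
    Hat R (C.obj k ⊗[R] PiTensorProduct R fun j => Hat R (Word C V (i j))) :=
  Hat.map (TensorProduct.map LinearMap.id (PiTensorProduct.map fun _ => Hat.of) ∘ₗ
      wordDecomp C V i)
    ((IsFil.tensorMap _ (IsFil.piMap fun _ => isFil_of)).comp (isFil_wordDecomp C V i))

/-- The completed tensor product `C(k) ⊗ uC(V)^{⊗ k}`. -/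
abbrev CofreePower (k : ℕ) : Type max u v w :=
  Hat R (C.obj k ⊗[R] PiTensorProduct R fun _ : Fin k => Cofree C V)

/-- The `(i₁, …, i_k)`-component of an element of `C(k) ⊗ uC(V)^{⊗ k}`. -/
def cofreePowerProj (i : Fin k → ℕ) : CofreePower C V k →ₗ[R]
    Hat R (C.obj k ⊗[R] PiTensorProduct R fun j => Hat R (Word C V (i j))) :=
  Hat.map (TensorProduct.map LinearMap.id (PiTensorProduct.map fun j => cofreeProj C V (i j)))
    (IsFil.tensorMap _ (IsFil.piMap fun j => isFil_cofreeProj C V (i j)))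

variable {C V} in
/-- The graph of the structure maps `uC(V) → C(k) ⊗ uC(V)^{⊗ k}` of the `uC`-coalgebra `uC(V)`:
`y` is the arity `k` coproduct of `x` if its components are obtained by decomposing `x`. -/
def IsCoproduct (x : Cofree C V) (y : CofreePower C V k) : Prop :=
  ∀ i : Fin k → ℕ, cofreePowerProj C V i y = hatDecomp C V i (cofreeProj C V (∑ j, i j) x)

/-- The map `d ⊗ 1 + 1 ⊗ (Q ⊗ 1 ⊗ ⋯ ⊗ 1 + ⋯ + 1 ⊗ ⋯ ⊗ 1 ⊗ Q)`, with Koszul signs, on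
`C(k) ⊗ uC(V)^{⊗ k}`. -/
def cofreeLeibniz (Q : Cofree C V →ₗ[R] Cofree C V) (hQ : IsFil Q) (k : ℕ) :
    CofreePower C V k →ₗ[R] CofreePower C V k :=
  Hat.map (leibniz (X := fun _ : Fin k => Cofree C V) (C.S.d k) fun _ => Q)
    (isFil_leibniz (M := C.obj k) (X := fun _ : Fin k => Cofree C V) (C.S.d k) fun _ => hQ)

variable {C V} in
/-- `x` is homogeneous of degree `p`. -/
def IsHomogeneous (p : ℤ) (x : Cofree C V) : Prop :=
  ∀ r n, ∃ y ∈ tensorGr (C.S.gr r) (fun _ : Fin r => V.gr) p,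
    Hat.proj n (cofreeProj C V r x) = Submodule.Quotient.mk y

/-- A curved (complete) `ΩC`-algebra structure on `V`: a filtered coderivation `Q` of degree `-1`
of `uC(V)` with `Q² = 0`. -/
structure CurvedAlgebra where
  Q : Cofree C V →ₗ[R] Cofree C V
  isFil : IsFil Q
  degree : ∀ p x, IsHomogeneous p x → IsHomogeneous (p - 1) (Q x)
  coderivation : ∀ (k : ℕ) (x : Cofree C V) (y : CofreePower C V k),
    IsCoproduct x y → IsCoproduct (Q x) (cofreeLeibniz C V Q isFil k y)
  square_zero : ∀ x, Q (Q x) = 0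

/-- The projection of `C(r) ⊗ V^{⊗ r}` to `C(0) = R`, which is zero for `r ≠ 0`. -/
def wordCounit : (r : ℕ) → Word C V r →ₗ[R] R
  | 0 => (TensorProduct.lid R R).toLinearMap ∘ₗ TensorProduct.map C.arityZero.toLinearMap
      (PiTensorProduct.isEmptyEquiv (Fin 0)).toLinearMap
  | _ + 1 => 0

/-- The projection of `C(r) ⊗ V^{⊗ r}` to the cogenerators `C(1) ⊗ V = V`, which is zero for
`r ≠ 1`. -/
def wordTangent : (r : ℕ) → Word C V r →ₗ[R] V.carrier
  | 0 => 0
  | 1 => (TensorProduct.lid R V.carrier).toLinearMap ∘ₗ TensorProduct.map C.C.counit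
      (PiTensorProduct.subsingletonEquiv (R := R) (s := fun _ : Fin 1 => V.carrier) 0).toLinearMap
  | _ + 2 => 0

/-- The projection of the generalized shuffle product to cogenerators: it takes `1 ⊗ v` and
`v ⊗ 1` to `v`, for `v` in `V`, and is zero otherwise. -/
def cogenStar (a b : ℕ) : Word C V a ⊗[R] Word C V b →ₗ[R] V.carrier :=
  (TensorProduct.lid R V.carrier).toLinearMap ∘ₗ
      TensorProduct.map (wordCounit C V a) (wordTangent C V b)
    + (TensorProduct.rid R V.carrier).toLinearMap ∘ₗ
      TensorProduct.map (wordTangent C V a) (wordCounit C V b)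

theorem isFil_wordTangent (r : ℕ) : IsFil (wordTangent C V r) := by
  match r with
  | 0 => exact fun n z _ => Submodule.zero_mem _
  | (_ + 2) => exact fun n z _ => Submodule.zero_mem _
  | 1 =>
    have h1 : IsFil (PiTensorProduct.subsingletonEquiv (R := R)
        (s := fun _ : Fin 1 => V.carrier) 0).toLinearMap :=
      isFil_of_tprod fun d y hy => by
        rw [LinearEquiv.coe_coe, PiTensorProduct.subsingletonEquiv_apply_tprod]
        simpa using hy 0
    refine IsFil.comp (N := R ⊗[R] V.carrier) (isFil_of_tmul fun n t y hy => ?_)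
      (IsFil.tensorMap C.C.counit h1)
    rw [LinearEquiv.coe_coe, TensorProduct.lid_tmul]
    exact Submodule.smul_mem _ _ hy

theorem wordCounit_fil (r n : ℕ) (z : Word C V r) (hz : z ∈ Fil.fil (R := R) (n + 1)) :
    wordCounit C V r z = 0 := by
  match r with
  | (_ + 1) => rfl
  | 0 =>
    have h0 : Fil.fil (R := R) (M := PiTensorProduct R fun _ : Fin 0 => V.carrier) (n + 1)
        = ⊥ := by
      refine Submodule.span_eq_bot.mpr ?_
      rintro _ ⟨d, y, _, hd, _⟩
      simp at hd
    have h : Fil.fil (R := R) (M := Word C V 0) (n + 1) ≤ ⊥ := by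
      refine Submodule.span_le.mpr ?_
      rintro _ ⟨m, y, hy, rfl⟩
      rw [h0, Submodule.mem_bot] at hy
      simp [hy]
    rw [(Submodule.mem_bot R).mp (h hz), map_zero]

theorem cogenStar_tmul (a b : ℕ) (z : Word C V a) (y : Word C V b) :
    cogenStar C V a b (z ⊗ₜ y)
      = wordCounit C V a z • wordTangent C V b y + wordCounit C V b y • wordTangent C V a z := by
  simp [cogenStar]

theorem cogenStar_mem_left (a b n : ℕ) (z : Word C V a) (y : Word C V b)
    (hz : z ∈ Fil.fil (R := R) n) : cogenStar C V a b (z ⊗ₜ y) ∈ Fil.fil (R := R) n := by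
  cases n with
  | zero => rw [Fil.zero]; trivial
  | succ n =>
    rw [cogenStar_tmul, wordCounit_fil C V a n z hz, zero_smul, zero_add]
    exact Submodule.smul_mem _ _ (isFil_wordTangent C V a _ _ hz)

theorem cogenStar_mem_right (a b n : ℕ) (z : Word C V a) (y : Word C V b)
    (hy : y ∈ Fil.fil (R := R) n) : cogenStar C V a b (z ⊗ₜ y) ∈ Fil.fil (R := R) n := by
  cases n with
  | zero => rw [Fil.zero]; trivial
  | succ n =>
    rw [cogenStar_tmul, wordCounit_fil C V b n y hy, zero_smul, add_zero]
    exact Submodule.smul_mem _ _ (isFil_wordTangent C V b _ _ hy)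

theorem isEven_of_par {M N : Type*} [AddCommGroup M] [Module R M] [AddCommGroup N] [Module R N]
    [Parity R M] [Parity R N] {f : M →ₗ[R] N}
    (h : f ∘ₗ Parity.odd (R := R) = Parity.odd (R := R) ∘ₗ f) : IsEven f :=
  isEven_of_odd fun z => (LinearMap.congr_fun h z).symm

theorem arityZero_isPar (c : C.obj 0) : IsPar R 0 c := by
  obtain ⟨t, rfl⟩ := C.unitary.2 c
  have h : Parity.odd (R := R) (C.unit 0) = 0 := by
    have := C.unit_gr 0
    change DirectSum.toModule R ℤ (C.obj 0) (fun n => if Odd n then (C.S.gr 0 n).subtype else 0)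
      (DirectSum.decompose (C.S.gr 0) (C.unit 0)) = 0
    rw [DirectSum.decompose_of_mem _ this, ← DirectSum.lof_eq_of R, DirectSum.toModule_lof]
    simp
  simp [IsPar, par, h]

theorem counit_even : IsEven C.C.counit := by
  refine isEven_of_odd fun z => ?_
  change 0 = _
  symm
  refine DirectSum.Decomposition.inductionOn (C.S.gr 1) (by simp) (fun {n} y => ?_)
    (fun a b ha hb => by simp only [map_add, ha, hb, add_zero]) z
  change C.C.counit (DirectSum.toModule R ℤ (C.obj 1)
    (fun n => if Odd n then (C.S.gr 1 n).subtype else 0)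
      (DirectSum.decompose (C.S.gr 1) (y : C.obj 1))) = 0
  rw [DirectSum.decompose_coe, ← DirectSum.lof_eq_of R, DirectSum.toModule_lof]
  split_ifs with hn
  · refine C.C.counit_gr n _ ?_ y.2
    rintro rfl; simp at hn
  · simp

theorem lid_even {M : Type*} [AddCommGroup M] [Module R M] [Parity R M] :
    IsEven (TensorProduct.lid R M).toLinearMap := by
  refine isEven_of_odd fun z => ?_
  induction z using TensorProduct.induction_on with
  | zero => simp
  | add a b ha hb => simp only [map_add, ha, hb]
  | tmul t m =>
    have h1 : ∀ e : ZMod 2, par R e t = if e = 0 then t else 0 :=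
      IsPar.apply (a := 0) (by simp [IsPar, par, Parity.odd])
    change _ = TensorProduct.lid R M ((∑ a : ZMod 2, TensorProduct.map (par R a)
      (par R (1 + a))) (t ⊗ₜ m))
    rw [LinearMap.sum_apply, Finset.sum_eq_single 0]
    · rw [TensorProduct.map_tmul, h1]; simp [par]
    · intro b _ hb; rw [TensorProduct.map_tmul, h1, if_neg hb]; simp
    · simp

theorem rid_even {M : Type*} [AddCommGroup M] [Module R M] [Parity R M] :
    IsEven (TensorProduct.rid R M).toLinearMap := by
  refine isEven_of_odd fun z => ?_
  induction z using TensorProduct.induction_on with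
  | zero => simp
  | add a b ha hb => simp only [map_add, ha, hb]
  | tmul m t =>
    have h1 : ∀ e : ZMod 2, par R e t = if e = 0 then t else 0 :=
      IsPar.apply (a := 0) (by simp [IsPar, par, Parity.odd])
    change _ = TensorProduct.rid R M ((∑ a : ZMod 2, TensorProduct.map (par R a)
      (par R (1 + a))) (m ⊗ₜ t))
    rw [LinearMap.sum_apply, Finset.sum_eq_single 1]
    · rw [TensorProduct.map_tmul, h1, show (1 : ZMod 2) + 1 = 0 by decide]; simp [par]
    · intro b _ hb
      have hb0 : b = 0 := (zmod2_cases b).resolve_right hb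
      rw [TensorProduct.map_tmul, h1, hb0]; simp
    · simp

theorem IsEven.comp {M N P : Type*} [AddCommGroup M] [Module R M] [AddCommGroup N] [Module R N]
    [AddCommGroup P] [Module R P] [Parity R M] [Parity R N] [Parity R P]
    {g : N →ₗ[R] P} {f : M →ₗ[R] N} (hg : IsEven g) (hf : IsEven f) : IsEven (g ∘ₗ f) :=
  fun e z hz => hg e _ (hf e z hz)

theorem IsEven.add {M N : Type*} [AddCommGroup M] [Module R M] [AddCommGroup N] [Module R N]
    [Parity R M] [Parity R N] {g f : M →ₗ[R] N} (hg : IsEven g) (hf : IsEven f) :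
    IsEven (g + f) := by
  intro e z hz
  unfold IsPar
  rw [LinearMap.add_apply, map_add, hg e z hz, hf e z hz]

theorem isEven_zero {M N : Type*} [AddCommGroup M] [Module R M] [AddCommGroup N] [Module R N]
    [Parity R M] [Parity R N] : IsEven (0 : M →ₗ[R] N) := fun e z _ => by simp [IsPar]

theorem wordCounit_even (r : ℕ) : IsEven (wordCounit C V r) := by
  match r with
  | (_ + 1) => exact isEven_zero
  | 0 =>
    refine lid_even.comp (IsEven.tensorMap (fun e c hc => ?_) (isEven_of_par ?_))
    · have h := (arityZero_isPar C c).apply e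
      rw [hc] at h
      split_ifs at h with he
      · subst he; simp [IsPar, par, Parity.odd]
      · simp [h, IsPar]
    · apply hom_ext_par
      intro a z hz
      have h := IsPar.tprod hz
      have h1 : Parity.odd (R := R) (PiTensorProduct.tprod R z) = 0 := by
        have := h.apply 1
        simpa [par] using this
      simp [Parity.odd]

theorem wordTangent_even (r : ℕ) : IsEven (wordTangent C V r) := by
  match r with
  | 0 => exact isEven_zero
  | (_ + 2) => exact isEven_zero
  | 1 =>
    refine lid_even.comp (IsEven.tensorMap (counit_even C) (isEven_of_par ?_))
    apply hom_ext_par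
    intro a z hz
    have h1 := (IsPar.tprod hz).apply 1
    have h2 := (hz 0).apply 1
    simp only [par, if_true] at h1 h2
    simp only [LinearMap.comp_apply, h1, LinearEquiv.coe_coe,
      PiTensorProduct.subsingletonEquiv_apply_tprod, h2]
    simp only [Finset.univ_unique, Fin.default_eq_zero, Finset.sum_singleton]
    split_ifs
    · rw [PiTensorProduct.subsingletonEquiv_apply_tprod]
    · simp

theorem cogenStar_even (a b : ℕ) : IsEven (cogenStar C V a b) :=
  (lid_even.comp ((wordCounit_even C V a).tensorMap (wordTangent_even C V b))).add
    (rid_even.comp ((wordTangent_even C V a).tensorMap (wordCounit_even C V b)))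

/-- The part of the generalized shuffle product that takes the summands of sizes
`i₁ + ⋯ + i_k` and `j₁ + ⋯ + j_k` to arity `k`: both factors are decomposed, the operations in
`C(k)` are multiplied, and `cogenStar` is applied to the remaining `k` pairs of factors. -/
def starWord (i j : Fin k → ℕ) :
    Word C V (∑ l, i l) →ₗ[R] Word C V (∑ l, j l) →ₗ[R] Word C V k :=
  (TensorProduct.curry (pairing (C.mul k) fun l => cogenStar C V (i l) (j l))).compl₁₂
    (wordDecomp C V i) (wordDecomp C V j)

theorem isFil_starWord (i j : Fin k → ℕ) : IsFil₂ (starWord C V i j) where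
  left n z _ hz := pairing_mem_left (C.mul k) (fun _ n z y => cogenStar_mem_left C V _ _ n z y)
    n _ _ (isFil_wordDecomp C V i n z hz)
  right n _ y hy := pairing_mem_right (C.mul k) (fun _ n z y => cogenStar_mem_right C V _ _ n z y)
    n _ _ (isFil_wordDecomp C V j n y hy)

theorem starWord_act (σ : Equiv.Perm (Fin k)) (i j : Fin k → ℕ) (z : Word C V (∑ l, i l))
    (y : Word C V (∑ l, j l)) :
    wordAct C V σ (starWord C V i j z y)
      = starWord C V (fun l => i (σ.symm l)) (fun l => j (σ.symm l))
        (wordAct C V (blockPerm σ i) z) (wordAct C V (blockPerm σ j) y) := by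
  have h := pairing_permute (C.mul k) (fun l => cogenStar_even C V (i l) (j l)) σ (C.S.act σ)
    (C.S.act_even σ) (fun a b => C.act_mul σ a b) (wordDecomp C V i z) (wordDecomp C V j y)
  rw [← wordDecomp_act, ← wordDecomp_act] at h
  exact h

/-- The arity `k` component of the generalized shuffle product. -/
def starComponent (k : ℕ) : Cofree C V →ₗ[R] Cofree C V →ₗ[R] Hat R (Word C V k) :=
  ∑ i : Fin k → Fin 2, ∑ j : Fin k → Fin 2,
    (Hat.map₂ (starWord C V (fun l => (i l : ℕ)) fun l => (j l : ℕ))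
      (isFil_starWord C V _ _)).compl₁₂ (cofreeProj C V _) (cofreeProj C V _)

theorem starComponent_act {a b : ℕ} (e : Fin a ≃ Fin b) (z y : Cofree C V) :
    Hat.map (wordAct C V e) (isFil_wordAct C V e) (starComponent C V a z y)
      = starComponent C V b z y := by
  obtain rfl : a = b := by simpa using Fintype.card_congr e
  have key : ∀ i j : Fin a → ℕ, Hat.map (wordAct C V e) (isFil_wordAct C V e)
      (Hat.map₂ (starWord C V i j) (isFil_starWord C V i j) (cofreeProj C V _ z)
        (cofreeProj C V _ y))
      = Hat.map₂ (starWord C V (fun l => i (e.symm l)) fun l => j (e.symm l))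
        (isFil_starWord C V _ _) (cofreeProj C V _ z) (cofreeProj C V _ y) := by
    intro i j
    rw [← z.act_proj (blockPerm e i), ← y.act_proj (blockPerm e j)]
    apply Hat.ext
    intro n
    rw [Hat.proj_map, Hat.proj_map₂, Hat.proj_map₂, Hat.proj_map, Hat.proj_map]
    obtain ⟨z', hz⟩ := Submodule.Quotient.mk_surjective _ (Hat.proj n (cofreeProj C V (∑ l, i l) z))
    obtain ⟨y', hy⟩ := Submodule.Quotient.mk_surjective _ (Hat.proj n (cofreeProj C V (∑ l, j l) y))
    rw [← hz, ← hy, quotMap₂_mk, Submodule.mapQ_apply, Submodule.mapQ_apply, Submodule.mapQ_apply,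
      quotMap₂_mk, starWord_act]
  unfold starComponent
  simp only [LinearMap.sum_apply, map_sum, LinearMap.compl₁₂_apply, key]
  exact Fintype.sum_equiv (Equiv.arrowCongr e (Equiv.refl (Fin 2))) _ _ fun i =>
    Fintype.sum_equiv (Equiv.arrowCongr e (Equiv.refl (Fin 2))) _ _ fun j => rfl

/-- The generalized shuffle product `⋆` on `uC(V)`, i.e. the morphism of `uC`-coalgebras from the
tensor product `uC(V) ⊗ uC(V)` that is induced, by cofreeness, by the linear map to the
cogenerators with `1 ⋆ v = v ⋆ 1 = v` and zero otherwise.  (The summands for `i` or `j` with a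
value `≥ 2` vanish.) -/
def star : Cofree C V →ₗ[R] Cofree C V →ₗ[R] Cofree C V :=
  LinearMap.mk₂ R
    (fun z => cofreeLift C V (fun k => starComponent C V k z)
      fun y _ _ e => starComponent_act C V e z y)
    (fun a b c => Cofree.ext fun r => by simp [cofreeProj_lift])
    (fun t a b => Cofree.ext fun r => by simp [cofreeProj_lift])
    (fun a b c => Cofree.ext fun r => by simp [cofreeProj_lift])
    (fun t a b => Cofree.ext fun r => by simp [cofreeProj_lift])

/-- The element `η_r ⊗ v^{⊗ r}` of `C(r) ⊗ V^{⊗ r}`. -/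
def etaWord (v : V.carrier) (r : ℕ) : Word C V r :=
  C.unit r ⊗ₜ PiTensorProduct.tprod R fun _ => v

variable {V} in
theorem degree_zero_isPar (v : V.gr 0) : IsPar R 0 (v : V.carrier) := by
  have h : Parity.odd (R := R) (v : V.carrier) = 0 := by
    change DirectSum.toModule R ℤ V.carrier (fun n => if Odd n then (V.gr n).subtype else 0)
      (DirectSum.decompose V.gr (v : V.carrier)) = 0
    rw [DirectSum.decompose_coe, ← DirectSum.lof_eq_of R, DirectSum.toModule_lof]
    simp
  simp [IsPar, par, h]

variable {V} in
theorem wordAct_etaWord (v : V.gr 0) {a b : ℕ} (e : Fin a ≃ Fin b) :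
    wordAct C V e (etaWord C V v a) = etaWord C V v b := by
  unfold wordAct etaWord
  rw [TensorProduct.map_tmul, C.act_unit]
  congr 1
  exact (permute_tprod (R := R) (a := fun _ => 0) e fun _ => degree_zero_isPar v).trans
    (by simp [permSign, sg])

variable {V} in
/-- The element `η_r ⊗ v^{⊗ r}` of the arity `r` part of `uC(V)`, for `v` of degree zero. -/
def etaPow (v : V.gr 0) (r : ℕ) : Cofree C V :=
  ⟨fun s => if s = r then Hat.of (etaWord C V v s) else 0, fun a b e => by
    obtain rfl : a = b := by simpa using Fintype.card_congr e
    dsimp only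
    split_ifs
    · rw [Hat.map_of, wordAct_etaWord]
    · rw [map_zero]⟩

variable {V} in
/-- The grouplike element `(η_r ⊗ v^{⊗ r})_{r ≥ 0}` of `uC(V)`, for `v` of degree zero. -/
def groupLike (v : V.gr 0) : Cofree C V :=
  ⟨fun s => Hat.of (etaWord C V v s), fun a b e => by
    rw [Hat.map_of, wordAct_etaWord]⟩

variable {V} in
/-- The one parameter subgroup `γ_v : R[G] → uC(V)`, where `R[G]` is the group ring of the additive
group `G` of `R`, with the `uC`-coalgebra structure for which the coproducts of the basis
elements `g_λ` are the `η_r ⊗ g_λ^{⊗ r}`.  It is the morphism of `uC`-coalgebras that is induced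
by the linear map `R[G] → V` with `g_λ ↦ λ v`. -/
def oneParam (v : V.gr 0) : (R →₀ R) →ₗ[R] Cofree C V :=
  Finsupp.linearCombination R fun t : R => groupLike C (t • v)

variable {V} in
/-- The exponential map `exp(v) = γ_v(g₁)`. -/
def exp (v : V.gr 0) : Cofree C V := oneParam C v (Finsupp.single 1 1)

/-- The element `1` of `uC(V)`, given by the unitary operation in `C(0) = R`. -/
def one : Cofree C V := etaPow C (0 : V.gr 0) 0

/-- The projection `T : uC(V) → V` to the cogenerators.  (It takes values in the completion of
the sum of the `V_p`, whose part of degree `p` is `V_p`.) -/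
def tangent : Cofree C V →ₗ[R] Hat R V.carrier :=
  Hat.map (wordTangent C V 1) (isFil_wordTangent C V 1) ∘ₗ cofreeProj C V 1

variable {C V}

/-- The map `Q̃ = T ∘ Q : uC(V) → V` that corresponds to a coderivation `Q`. -/
def CurvedAlgebra.corestriction (A : CurvedAlgebra C V) : Cofree C V →ₗ[R] Hat R V.carrier :=
  tangent C V ∘ₗ A.Q

/-- The twisted differential `Q^v(x) = exp(-v) ⋆ Q(exp(v) ⋆ x)`. -/
def CurvedAlgebra.twist (A : CurvedAlgebra C V) (v : V.gr 0) : Cofree C V →ₗ[R] Cofree C V :=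
  star C V (exp C (-v)) ∘ₗ A.Q ∘ₗ star C V (exp C v)

/-- The curvature `T(Q(1))` of a differential `Q` on `uC(V)`. -/
def curvature (Q : Cofree C V →ₗ[R] Cofree C V) : Hat R V.carrier := tangent C V (Q (one C V))

/-- A differential on `uC(V)` is flat if its curvature is zero. -/
def IsFlat (Q : Cofree C V →ₗ[R] Cofree C V) : Prop := curvature Q = 0

/-- The Maurer-Cartan equation `Q̃(exp(v)) = 0`. -/
def CurvedAlgebra.IsMaurerCartan (A : CurvedAlgebra C V) (v : V.gr 0) : Prop :=
  A.corestriction (exp C v) = 0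

/-- The convergence of the series `∑_{r ≥ 0} a_r` to `s`, with respect to a filtration. -/
def FilHasSum {M : Type x} [AddCommGroup M] [Module R M] [Fil R M] (a : ℕ → M) (s : M) : Prop :=
  ∀ n, ∃ N, ∀ m ≥ N, s - ∑ r ∈ Finset.range m, a r ∈ Fil.fil (R := R) n

end cofree

end

end HopfTwist

/-! The exponential `exp(v)` is the grouplike family `(η_r ⊗ v^{⊗ r})_r`, and `1` is the grouplike
family of `v = 0`. Grouplike elements multiply under `⋆` by adding their parameters
(`star_groupLike`), so `exp(v) ⋆ 1 = exp(v)` and `Q^v(1) = exp(-v) ⋆ Q(exp(v))`.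

The remaining factor `exp(-v)` is invisible to `T`. For a grouplike `g`, the value `T(g ⋆ x)` has
two contributions: the arity 0 part of `g`, which is `1`, against the arity 1 part of `x`, giving
`T(x)`; and the arity 1 part of `g` against the arity 0 part of `x`. The second one disappears when
`x` has no arity 0 part (`tangent_star_groupLike`). This applies to `x = Q(exp(v))`, which has
degree `-1`, whereas `C(0) = R η_0` sits in degree 0 (`IsHomogeneous.cofreeProj_zero`). Hence the
curvature of the twist is equal to `Q̃(exp(v))` (`CurvedAlgebra.curvature_twist`), and the
equivalence is immediate.

The products can be computed because units are preserved by the decomposition maps of a Hopf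
cooperad and because `η_r` and `v` have degree zero, so that no Koszul sign appears.

For the series, `V = F¹V` puts `η_r ⊗ v^{⊗ r}` into `F^r`. The partial sums therefore converge to
`exp(v)`, and `T ∘ Q` preserves the filtration. -/

namespace HopfTwist

variable {R : Type u} [CommRing R]

/-! ### Absence of Koszul signs for even factors on the left. -/

section signs
variable {k : ℕ} {M : Type x} [AddCommGroup M] [Module R M]
  {X : Fin k → Type v} {Y : Fin k → Type w}
  [∀ i, AddCommGroup (X i)] [∀ i, Module R (X i)] [∀ i, Parity R (X i)]
  [∀ i, AddCommGroup (Y i)] [∀ i, Module R (Y i)] [∀ i, Parity R (Y i)]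

/-- Interleaving with even factors on the left involves no signs. -/
theorem interleave_tprod_of_even {z : ∀ i, X i} (hz : ∀ i, IsPar R 0 (z i)) (y : ∀ i, Y i) :
    interleave (PiTensorProduct.tprod R z ⊗ₜ[R] PiTensorProduct.tprod R y)
      = PiTensorProduct.tprod R fun j => z j ⊗ₜ[R] y j := by
  -- Both sides are linear in the tensor of the `y i`, so homogeneous `y` suffice. Every term of the
  -- sign exponent contains the parity of some `z j`, which is zero.
  have h : interleave (R := R) (X := X) (Y := Y) ∘ₗ
      TensorProduct.mk R _ _ (PiTensorProduct.tprod R z)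
      = PiTensorProduct.map fun j => TensorProduct.mk R (X j) (Y j) (z j) := by
    apply hom_ext_par
    intro b y hy
    rw [LinearMap.comp_apply, TensorProduct.mk_apply,
      interleave_tprod (a := fun _ => 0) hz hy, PiTensorProduct.map_tprod]
    simp [interSign, sg]
  have := LinearMap.congr_fun h (PiTensorProduct.tprod R y)
  simpa using this

theorem IsPar.tprod_zero {z : ∀ i, X i} (hz : ∀ i, IsPar R 0 (z i)) :
    IsPar R 0 (PiTensorProduct.tprod R z) := by
  simpa using IsPar.tprod (R := R) (a := fun _ => 0) hz

/-- The product of pure tensors involves no signs if the inner left factor is even. -/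
theorem pairing_tprod_of_even {Z : Type*} [AddCommGroup Z] [Module R Z] [Parity R M]
    (μ : M ⊗[R] M →ₗ[R] M) (t : ∀ j, X j ⊗[R] Y j →ₗ[R] Z) (m m' : M)
    {z : ∀ i, X i} (hz : ∀ i, IsPar R 0 (z i)) (y : ∀ i, Y i) :
    pairing μ t ((m ⊗ₜ PiTensorProduct.tprod R z) ⊗ₜ (m' ⊗ₜ PiTensorProduct.tprod R y))
      = μ (m ⊗ₜ m') ⊗ₜ PiTensorProduct.tprod R fun j => t j (z j ⊗ₜ y j) := by
  -- The outer sum runs over the parity of the tensor of the `z i`, which is even; only the index 0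
  -- contributes.
  rw [pairing_tmul, Finset.sum_eq_single 0]
  · rw [(IsPar.tprod_zero hz : par R 0 _ = _), interleave_tprod_of_even hz,
      PiTensorProduct.map_tprod]
    simp only [zero_mul, sg, zero_ne_one, if_false, one_smul]
    -- With all signs equal to 1, the even and odd parts of `m'` add up to `m'` again.
    rw [← TensorProduct.sum_tmul, ← map_sum, ← TensorProduct.tmul_sum, par_sum_apply]
  · intro b _ hb
    rw [(IsPar.tprod_zero hz).apply, if_neg hb]
    simp
  · simp

end signs

/-! ### Homogeneous elements of a graded module. -/

section gradings
variable {M : Type v} [AddCommGroup M] [Module R M] (gr : ℤ → Submodule R M)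
  [DirectSum.Decomposition gr]

/-- The decomposition of `z` has its only component in degree 0, which the odd projection kills. The
parity is introduced by `let` because `gradingParity` is not an instance for a general grading. -/
theorem gradingParity_isPar_zero {z : M} (hz : z ∈ gr 0) :
    let _ := gradingParity gr
    IsPar R 0 z := by
  let _ := gradingParity gr
  have h : Parity.odd (R := R) z = 0 := by
    change DirectSum.toModule R ℤ M (fun n => if Odd n then (gr n).subtype else 0)
      (DirectSum.decompose gr z) = 0
    rw [DirectSum.decompose_of_mem _ hz, ← DirectSum.lof_eq_of R, DirectSum.toModule_lof]
    simp
  simp [IsPar, par, h]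

/-- The component of `z` in degree `m` is `z` by `hm` and zero by `hn`. This is what confines
`C(0)`, spanned by `η_0`, to degree zero. -/
theorem eq_zero_of_mem_gr {m n : ℤ} (h : m ≠ n) {z : M} (hm : z ∈ gr m) (hn : z ∈ gr n) :
    z = 0 := by
  rw [← DirectSum.decompose_of_mem_same gr hm, DirectSum.decompose_of_mem_ne gr hn h.symm]

end gradings

/-! ### Parity of the units and of the words `η_r ⊗ v^{⊗ r}`. -/

variable (C : HopfCooperad.{u, v} R) (V : CompleteGradedModule.{u, w} R)

theorem unit_isPar (r : ℕ) : IsPar R 0 (C.unit r) :=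
  gradingParity_isPar_zero (C.S.gr r) (C.unit_gr r)

variable {V}

theorem etaWord_isPar (v : V.gr 0) (r : ℕ) : IsPar R 0 (etaWord C V (v : V.carrier) r) := by
  have h := (unit_isPar C r).tmul (IsPar.tprod_zero fun _ : Fin r => degree_zero_isPar v)
  rwa [add_zero] at h

/-! ### Decomposition, product and projections of words with operation `η_r`. -/

section words
variable {k : ℕ}

/-- The decomposition maps are unital, so a unit decomposes into units. Since units are even, they
pass the letters without a sign, whatever the parities of the letters. -/
theorem wordDecomp_unit_tmul (i : Fin k → ℕ) (x : Fin (∑ j, i j) → V.carrier) :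
    wordDecomp C V i (C.unit _ ⊗ₜ PiTensorProduct.tprod R x)
      = C.unit k ⊗ₜ PiTensorProduct.tprod R fun j =>
        C.unit (i j) ⊗ₜ PiTensorProduct.tprod R fun m => x (finSigmaFinEquiv ⟨j, m⟩) := by
  unfold wordDecomp regroup
  rw [LinearMap.comp_apply, TensorProduct.map_tmul, C.decomp_unit, split_tprod,
    LinearMap.comp_apply, LinearEquiv.coe_coe, TensorProduct.assoc_tmul,
    LinearMap.lTensor_tmul]
  rw [interleave_tprod_of_even fun j => unit_isPar C (i j)]

/-- Both words decompose into words with unit operations, the outer operations multiply as `η_k η_k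
= η_k`, and the even words of the left factor cause no signs. The letters on the right are left
arbitrary: they are copies of `v'` in the product of grouplike elements, but general in the
computation of `T(g ⋆ x)`. -/
theorem starWord_etaWord (v : V.gr 0) (i j : Fin k → ℕ) (x : Fin (∑ l, j l) → V.carrier) :
    starWord C V i j (etaWord C V (v : V.carrier) _) (C.unit _ ⊗ₜ PiTensorProduct.tprod R x)
      = C.unit k ⊗ₜ PiTensorProduct.tprod R fun l => cogenStar C V (i l) (j l)
        (etaWord C V (v : V.carrier) (i l) ⊗ₜ
          (C.unit (j l) ⊗ₜ PiTensorProduct.tprod R fun m => x (finSigmaFinEquiv ⟨l, m⟩))) := by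
  have h : wordDecomp C V i (etaWord C V (v : V.carrier) _)
      = C.unit k ⊗ₜ PiTensorProduct.tprod R fun l => etaWord C V (v : V.carrier) (i l) :=
    wordDecomp_unit_tmul C i _
  unfold starWord
  rw [LinearMap.compl₁₂_apply, TensorProduct.curry_apply, h, wordDecomp_unit_tmul,
    pairing_tprod_of_even _ _ _ _ (fun l => etaWord_isPar C v (i l)), C.unit_mul]

theorem wordCounit_unit (x : Fin 0 → V.carrier) :
    wordCounit C V 0 (C.unit 0 ⊗ₜ PiTensorProduct.tprod R x) = 1 := by
  have h : C.arityZero (C.unit 0) = 1 := by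
    rw [HopfCooperad.arityZero, LinearEquiv.symm_apply_eq]
    exact (one_smul R (C.unit 0)).symm
  simp [wordCounit, h]

/-- The counit takes `η_1` to 1, which leaves the only letter. The arity is a variable `s` because
it occurs as a sum `∑ l : Fin 1, j l`, which is not literally `1`. -/
theorem wordTangent_unit {s : ℕ} (hs : s = 1) (x : Fin s → V.carrier) :
    wordTangent C V s (C.unit s ⊗ₜ PiTensorProduct.tprod R x) = x ⟨0, by omega⟩ := by
  subst hs
  simp [wordTangent, C.counit_unit]

end words

/-! ### Completed bilinear maps with one argument fixed. -/

theorem IsFil₂.isFil {M : Type v} {N : Type w} {P : Type x} [AddCommGroup M] [Module R M]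
    [AddCommGroup N] [Module R N] [AddCommGroup P] [Module R P] [Fil R M] [Fil R N] [Fil R P]
    {B : M →ₗ[R] N →ₗ[R] P} (hB : IsFil₂ B) (m : M) : IsFil (B m) :=
  fun n z hz => hB.right n m z hz

/-- The components of a grouplike element lie in the image of `Hat.of`. Multiplication by them thus
becomes the completion of a linear map, which `Hat.map_map` can compose with further maps. -/
theorem Hat.map₂_of {M : Type v} {N : Type w} {P : Type x} [AddCommGroup M] [Module R M]
    [AddCommGroup N] [Module R N] [AddCommGroup P] [Module R P] [Fil R M] [Fil R N] [Fil R P]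
    (B : M →ₗ[R] N →ₗ[R] P) (hB : IsFil₂ B) (m : M) (y : Hat R N) :
    Hat.map₂ B hB (Hat.of m) y = Hat.map (B m) (hB.isFil m) y := rfl

/-! ### The group of grouplike elements. -/

/-- Of the four pairs of arities, `(0,1)` contributes `v'` and `(1,0)` contributes `v`. The pair
`(0,0)` has no cogenerator and `(1,1)` has no counit. This is the addition law behind the product of
grouplike elements. -/
theorem cogenStar_etaWord (v v' : V.carrier) :
    ∑ a : Fin 2, ∑ b : Fin 2, cogenStar C V a b (etaWord C V v a ⊗ₜ etaWord C V v' b)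
      = v + v' := by
  have h0 : ∀ v : V.carrier, wordCounit C V 0 (etaWord C V v 0) = 1 :=
    fun v => wordCounit_unit C _
  have h1 : ∀ v : V.carrier, wordTangent C V 1 (etaWord C V v 1) = v :=
    fun v => wordTangent_unit C rfl _
  have h2 : ∀ z, wordCounit C V 1 z = 0 := fun _ => rfl
  have h3 : ∀ z, wordTangent C V 0 z = 0 := fun _ => rfl
  simp [cogenStar_tmul, h0, h1, h2, h3, add_comm]

/-- A tensor power of `0` vanishes in positive arity, while the empty tensor in arity 0 survives.
Hence `1` is covered by the product formula for grouplike elements. -/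
theorem one_eq_groupLike : one C V = groupLike C (0 : V.gr 0) := by
  apply Cofree.ext
  intro r
  change (if r = 0 then Hat.of (etaWord C V ((0 : V.gr 0) : V.carrier) r) else 0)
    = Hat.of (etaWord C V ((0 : V.gr 0) : V.carrier) r)
  split_ifs with h
  · rfl
  · have h1 : (PiTensorProduct.tprod R fun _ : Fin r => ((0 : V.gr 0) : V.carrier)) = 0 :=
      MultilinearMap.map_coord_zero _ ⟨0, Nat.pos_of_ne_zero h⟩ rfl
    rw [etaWord, h1, TensorProduct.tmul_zero, map_zero]

/-- The grouplike elements form a group under the generalized shuffle product. -/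
theorem star_groupLike (v v' : V.gr 0) :
    star C V (groupLike C v) (groupLike C v') = groupLike C (v + v') := by
  apply Cofree.ext
  intro k
  change starComponent C V k _ _ = Hat.of (etaWord C V ((v + v' : V.gr 0) : V.carrier) k)
  -- Each summand comes from an uncompleted word, so the computation can take place before
  -- completion.
  have h : ∀ i j : Fin k → Fin 2, Hat.map₂ (starWord C V (fun l => (i l : ℕ)) fun l => (j l : ℕ))
      (isFil_starWord C V _ _) (cofreeProj C V _ (groupLike C v))
      (cofreeProj C V _ (groupLike C v'))
      = Hat.of (C.unit k ⊗ₜ PiTensorProduct.tprod R fun l => cogenStar C V (i l) (j l)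
        (etaWord C V (v : V.carrier) (i l) ⊗ₜ etaWord C V (v' : V.carrier) (j l))) :=
    fun i j => congrArg Hat.of (starWord_etaWord C v _ _ _)
  simp only [starComponent, LinearMap.sum_apply, LinearMap.compl₁₂_apply, h]
  simp only [← map_sum, ← TensorProduct.tmul_sum]
  refine congrArg (fun z => Hat.of (C.unit k ⊗ₜ[R] z)) ?_
  -- By multilinearity, summing pure tensors over all functions `j` is the same as summing over the
  -- values `0, 1` in each tensor factor separately. The same is done next for `i`, which leaves the
  -- four-term sum of `cogenStar_etaWord` in every factor.
  have h1 : ∀ i : Fin k → Fin 2, (∑ j : Fin k → Fin 2, PiTensorProduct.tprod R fun l =>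
      cogenStar C V (i l) (j l)
        (etaWord C V (v : V.carrier) (i l) ⊗ₜ etaWord C V (v' : V.carrier) (j l)))
      = PiTensorProduct.tprod R fun l => ∑ b : Fin 2, cogenStar C V (i l) b
        (etaWord C V (v : V.carrier) (i l) ⊗ₜ etaWord C V (v' : V.carrier) b) :=
    fun i => (MultilinearMap.map_sum (PiTensorProduct.tprod R) fun l (b : Fin 2) =>
      cogenStar C V (i l) b
        (etaWord C V (v : V.carrier) (i l) ⊗ₜ etaWord C V (v' : V.carrier) b)).symm
  simp only [h1]
  rw [← MultilinearMap.map_sum (PiTensorProduct.tprod R) fun _ (a : Fin 2) =>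
    ∑ b : Fin 2, cogenStar C V a b
        (etaWord C V (v : V.carrier) a ⊗ₜ etaWord C V (v' : V.carrier) b)]
  simp only [cogenStar_etaWord]
  rfl

/-! ### The projection to cogenerators of a product with a grouplike element. -/

/-- The cooperad is reduced: the counit is injective on `C(1)` and takes `η_1` to 1, so `t` is the
counit of `c`. -/
theorem exists_smul_unit {s : ℕ} (hs : s = 1) (c : C.obj s) : ∃ t : R, c = t • C.unit s := by
  subst hs
  exact ⟨C.C.counit c, C.reduced.1 (by simp [C.counit_unit])⟩

/-- A right factor of arity 1 has no counit part, so `cogenStar` can only pair its letter with the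
counit of the left factor. That counit is 1 on `η_0` and zero in positive arity. The form as an
identity of linear maps allows it to be extended to completions. -/
theorem wordTangent_starWord (v : V.gr 0) {i j : Fin 1 → ℕ} (hj : ∑ l, j l = 1) :
    wordTangent C V 1 ∘ₗ starWord C V i j (etaWord C V (v : V.carrier) _)
      = if i 0 = 0 then wordTangent C V (∑ l, j l) else 0 := by
  have hj0 : j 0 = 1 := by simpa using hj
  -- The arities are generalized to variables, so that `b = 1` can be substituted in the dependent
  -- type of `x`.
  have key : ∀ (a b : ℕ) (hb : b = 1) (x : Fin b → V.carrier), cogenStar C V a b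
      (etaWord C V (v : V.carrier) a ⊗ₜ (C.unit b ⊗ₜ PiTensorProduct.tprod R x))
      = if a = 0 then x ⟨0, by omega⟩ else 0 := by
    rintro a b rfl x
    rw [cogenStar_tmul, wordTangent_unit C rfl]
    have h2 : ∀ z, wordCounit C V 1 z = 0 := fun _ => rfl
    rw [h2, zero_smul, add_zero]
    match a with
    | 0 => rw [etaWord, wordCounit_unit, one_smul, if_pos rfl]
    | a + 1 =>
      have h3 : ∀ z, wordCounit C V (a + 1) z = 0 := fun _ => rfl
      rw [h3, zero_smul, if_neg a.succ_ne_zero]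
  apply TensorProduct.ext
  apply LinearMap.ext
  intro c
  apply PiTensorProduct.ext
  apply MultilinearMap.ext
  intro x
  -- Reducedness brings a general operation of arity 1 into the range of `starWord_etaWord`, which
  -- needs a unit on the right.
  obtain ⟨t, rfl⟩ := exists_smul_unit C hj c
  change wordTangent C V 1 (starWord C V i j _ ((t • C.unit _) ⊗ₜ PiTensorProduct.tprod R x))
    = (if i 0 = 0 then wordTangent C V (∑ l, j l) else 0)
      ((t • C.unit _) ⊗ₜ PiTensorProduct.tprod R x)
  rw [← TensorProduct.smul_tmul']
  simp only [map_smul]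
  rw [starWord_etaWord, wordTangent_unit C rfl]
  refine congrArg (t • ·) ((key (i 0) (j 0) hj0 _).trans ?_)
  split_ifs
  · rw [wordTangent_unit C hj]
    congr 1
  · rfl

theorem tangent_eq_of_eq {s : ℕ} (hs : s = 1) (x : Cofree C V) :
    Hat.map (wordTangent C V s) (isFil_wordTangent C V s) (cofreeProj C V s x)
      = tangent C V x := by
  subst hs; rfl

/-- Multiplication by a grouplike element does not change the projection to the cogenerators of an
element of the coaugmentation coideal. -/
theorem tangent_star_groupLike (v : V.gr 0) (x : Cofree C V) (hx : cofreeProj C V 0 x = 0) :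
    tangent C V (star C V (groupLike C v) x) = tangent C V x := by
  -- The hypothesis is restated for an index only propositionally equal to 0, since it will be used
  -- for the index `∑ l, j l`.
  have h0 : ∀ s : ℕ, s = 0 → cofreeProj C V s x = 0 := by rintro _ rfl; exact hx
  change Hat.map (wordTangent C V 1) (isFil_wordTangent C V 1)
    (starComponent C V 1 (groupLike C v) x) = _
  -- Only the arities 0 on the left and 1 on the right contribute. Arity 0 on the right is excluded
  -- by `hx`, and arities `(1,1)` by the form of `cogenStar`.
  have h : ∀ i j : Fin 1 → Fin 2, Hat.map (wordTangent C V 1) (isFil_wordTangent C V 1)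
      (Hat.map₂ (starWord C V (fun l => (i l : ℕ)) fun l => (j l : ℕ))
        (isFil_starWord C V _ _) (cofreeProj C V _ (groupLike C v)) (cofreeProj C V _ x))
      = if i = 0 ∧ j = 1 then tangent C V x else 0 := by
    intro i j
    have hi : i = 0 ↔ (i 0 : ℕ) = 0 := by
      rw [funext_iff, Fin.forall_fin_one, Fin.ext_iff]; rfl
    have hj : j = 1 ↔ ∑ l, (j l : ℕ) = 1 := by
      rw [funext_iff, Fin.forall_fin_one, Fin.ext_iff, Fin.sum_univ_one]; rfl
    by_cases h1 : ∑ l, (j l : ℕ) = 1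
    · have h2 := wordTangent_starWord C v (i := fun l => (i l : ℕ)) h1
      change Hat.map _ _ (Hat.map₂ _ _ (Hat.of (etaWord C V (v : V.carrier) _)) _) = _
      rw [Hat.map₂_of, Hat.map_map]
      by_cases h3 : (i 0 : ℕ) = 0
      · rw [if_pos ⟨hi.2 h3, hj.2 h1⟩]
        rw [if_pos h3] at h2
        simp only [h2]
        exact tangent_eq_of_eq C h1 x
      · rw [if_neg fun h => h3 (hi.1 h.1)]
        rw [if_neg h3] at h2
        simp only [h2]
        apply Hat.ext
        intro n
        rw [Hat.proj_map]
        simp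
    · rw [if_neg fun h => h1 (hj.1 h.2), h0, map_zero, map_zero]
      -- The single value of `j` lies in `Fin 2` and is not 1, so the arity of the right factor is
      -- 0.
      rw [Fin.sum_univ_one] at h1 ⊢
      omega
  simp only [starComponent, LinearMap.sum_apply, map_sum, LinearMap.compl₁₂_apply, h]
  simp [ite_and]

/-! ### The degree of the exponential and of the arity zero part. -/

theorem exp_eq_groupLike (v : V.gr 0) : exp C v = groupLike C v := by
  simp [exp, oneParam]

theorem etaWord_mem_tensorGr (v : V.gr 0) (r : ℕ) :
    etaWord C V (v : V.carrier) r ∈ tensorGr (C.S.gr r) (fun _ : Fin r => V.gr) 0 :=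
  Submodule.subset_span ⟨0, fun _ => 0, _, _, C.unit_gr r, fun _ => v.2, by simp, rfl⟩

theorem groupLike_isHomogeneous (v : V.gr 0) : IsHomogeneous 0 (groupLike C v) :=
  fun r _ => ⟨_, etaWord_mem_tensorGr C v r, rfl⟩

/-- The arity zero part of `uC(V)` is concentrated in degree zero. -/
theorem IsHomogeneous.cofreeProj_zero {p : ℤ} (hp : p ≠ 0) {x : Cofree C V}
    (hx : IsHomogeneous p x) : cofreeProj C V 0 x = 0 := by
  apply Hat.ext
  intro n
  obtain ⟨y, hy, h⟩ := hx 0 n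
  -- In arity 0 there are no letters, so the degree of a generator is that of its operation. The
  -- operation is a multiple of `η_0`, hence also of degree 0, and must vanish for `p ≠ 0`.
  have h0 : tensorGr (C.S.gr 0) (fun _ : Fin 0 => V.gr) p ≤ ⊥ := by
    refine Submodule.span_le.mpr ?_
    rintro _ ⟨q, _, c, z, hc, _, hq, rfl⟩
    obtain rfl : q = p := by simpa using hq
    obtain ⟨t, rfl⟩ := C.unitary.2 c
    have hc0 : t • C.unit 0 = 0 :=
      eq_zero_of_mem_gr (C.S.gr 0) hp hc (Submodule.smul_mem _ t (C.unit_gr 0))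
    simp [hc0]
  rw [h, (Submodule.mem_bot R).mp (h0 hy)]
  simp

/-! ### The exponential series in the filtration topology. -/

/-- Because `V = F¹V`, each of the `r` letters adds 1 to the filtration degree. -/
theorem etaWord_mem_fil (v : V.carrier) (r : ℕ) :
    etaWord C V v r ∈ Fil.fil (R := R) (M := Word C V r) r :=
  tmul_mem_fil _ (tprod_mem_fil (fun _ => 1)
    (fun _ => (V.fil_one ▸ Submodule.mem_top : v ∈ V.fil 1)) (by simp))

/-- In arity `s < m` the partial sum already contains the component of the grouplike element. In
arity `s ≥ m` it contains nothing, and the difference is `η_s ⊗ v^{⊗ s}`, an element of `F^s ⊆ F^m`.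
-/
theorem groupLike_sub_sum_mem (v : V.gr 0) (m : ℕ) :
    groupLike C v - ∑ r ∈ Finset.range m, etaPow C v r ∈ Fil.fil (R := R) m := by
  rw [mem_cofreeFil]
  intro s
  have h : ∀ r, cofreeProj C V s (etaPow C v r)
      = if s = r then Hat.of (etaWord C V (v : V.carrier) s) else 0 := fun _ => rfl
  rw [map_sub, map_sum]
  simp only [h, Finset.sum_ite_eq, Finset.mem_range]
  change Hat.of (etaWord C V (v : V.carrier) s) - _ ∈ _
  split_ifs with hs
  · rw [sub_self]; exact Submodule.zero_mem _
  · rw [sub_zero]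
    exact Fil.anti (not_lt.mp hs) (isFil_of _ _ (etaWord_mem_fil C _ s))

theorem isFil_tangent : IsFil (tangent C V) :=
  (isFil_hatMap _ (isFil_wordTangent C V 1)).comp (isFil_cofreeProj C V 1)

/-! ### The curvature of the twist and the Maurer–Cartan series. -/

variable {C}

/-- The curvature of the twist of `Q` by `v` is `Q̃(exp(v))`. -/
theorem CurvedAlgebra.curvature_twist (A : CurvedAlgebra C V) (v : V.gr 0) :
    curvature (A.twist v) = A.corestriction (exp C v) := by
  have h1 : star C V (exp C v) (one C V) = exp C v := by
    rw [one_eq_groupLike, exp_eq_groupLike, star_groupLike, add_zero]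
  -- `exp(v)` has degree 0, so `Q(exp(v))` has degree `0 - 1 ≠ 0` and no part in arity 0.
  have h2 : cofreeProj C V 0 (A.Q (exp C v)) = 0 := by
    rw [exp_eq_groupLike]
    exact (A.degree 0 _ (groupLike_isHomogeneous C v)).cofreeProj_zero C (by decide)
  unfold curvature twist corestriction
  simp only [LinearMap.comp_apply]
  -- By `h2`, the factor `exp(-v)` can be dropped under `T`.
  rw [h1, exp_eq_groupLike C (-v), tangent_star_groupLike C _ _ h2]

/-- `T ∘ Q` is linear and preserves the filtration, so it carries the remainder of the exponential
series after `m` terms into `F^m`. For precision `F^n` it therefore suffices to take `N = n`. -/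
theorem CurvedAlgebra.filHasSum_corestriction (A : CurvedAlgebra C V) (v : V.gr 0) :
    FilHasSum (R := R) (fun r : ℕ => A.corestriction (etaPow C v r))
      (A.corestriction (exp C v)) := by
  refine fun n => ⟨n, fun m hm => Fil.anti hm ?_⟩
  rw [← map_sum, ← map_sub, exp_eq_groupLike]
  exact (isFil_tangent C).comp A.isFil m _ (groupLike_sub_sum_mem C v m)

end HopfTwist

theorem mainTheorem3 {R : Type u} [CommRing R] (C : HopfTwist.HopfCooperad.{u, v} R)
    (hfin : ∀ (r : ℕ) (n : ℤ), Module.Finite R (C.S.gr r n))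
    (hproj : ∀ r : ℕ, Module.Projective R (C.obj r))
    (hfree : Nonempty (Algebra ℚ R) ∨
      ∀ r : ℕ, Module.Free (MonoidAlgebra R (Equiv.Perm (Fin r))) (C.S.rep r).asModule)
    (V : HopfTwist.CompleteGradedModule.{u, w} R) (A : HopfTwist.CurvedAlgebra C V)
    (v : V.gr 0) :
    (HopfTwist.IsFlat (A.twist v) ↔ A.IsMaurerCartan v) ∧
      HopfTwist.FilHasSum (R := R) (fun r : ℕ => A.corestriction (HopfTwist.etaPow C v r))
        (A.corestriction (HopfTwist.exp C v)) := by
  -- Once the curvature of the twist is rewritten as `Q̃(exp(v))`, flatness and the Maurer–Cartan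
  -- equation coincide by definition.
  exact ⟨by rw [HopfTwist.IsFlat, A.curvature_twist]; rfl, A.filHasSum_corestriction v⟩
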